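/- All digraphs are finite and may have loops, parallel edges and anti-parallel edges. A *cut* of a digraph $D$ is a non-empty set $D[X,Y]$ of all edges with one endpoint in $X$ and the other in $Y$, where $(X,Y)$ is a partition of $V(D)$. A *bond* is a cut that properly contains no other cut, and a bond $D[X,Y]$ is *directed* if no edge has its tail in $Y$ and its head in $X$. An *odd dijoin* of $D$ is a set $J\subseteq E(D)$ such that $|J\cap S|$ is odd for every directed bond $S$ of $D$. A non-loop edge $e=(x,y)$ of $D$ is *deletable* if $D$ contains a directed path from $x$ to $y$ that does not use $e$. For $A\subseteq E(D)$, the *contraction* $D/A$ is obtained by deleting the edges of $A$ and identifying each weak component of the subgraph formed by $A$ to a single vertex. A digraph $D_1$ is a *cut minor* of $D_2$ if, up to isomorphism, it can be obtained from $D_2$ by a finite sequence of edge contractions, deletions of deletable edges, and deletions of isolated vertices. A *one-direction* is a digraph obtained from a complete bipartite graph $K_{n_1,n_2}$ with $n_1,n_2\ge 2$ by orienting all edges from the class of size $n_1$ to the class of size $n_2$. A *diamond* is a digraph whose vertices are two distinct hubs $h_1,h_2$ and further vertices $x_1,\dots,x_n$ with $n\ge 3$, such that for each $i$ either there is exactly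 one edge from $x_i$ to each of $h_1,h_2$, or there is exactly one edge from each of $h_1,h_2$ to $x_i$, and there are no other edges. A diamond or one-direction is *odd* if its total number of vertices is odd. **Theorem.** A digraph $D$ has an odd dijoin if and only if it has neither an odd diamond nor an odd one-direction as a cut minor. -/

import Mathlib

universe u v u' v'

/-- A directed multigraph: loops, parallel and anti-parallel edges are allowed. The edge `e` goes
from `D.tail e` to `D.head e`. -/
structure MultiDigraph where
  V : Type u
  E : Type v
  tail : E → V
  head : E → V

namespace MultiDigraph

/-- Isomorphism of directed multigraphs. -/
structure Iso (D : MultiDigraph.{u, v}) (D' : MultiDigraph.{u', v'}) where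
  vert : D.V ≃ D'.V
  edge : D.E ≃ D'.E
  tail_eq : ∀ e, D'.tail (edge e) = vert (D.tail e)
  head_eq : ∀ e, D'.head (edge e) = vert (D.head e)

/-- The edges with one endpoint in `X` and the other one in the complement of `X`. -/
def cutSet (D : MultiDigraph.{u, v}) (X : Set D.V) : Set D.E :=
  {e | (D.tail e ∈ X ∧ D.head e ∉ X) ∨ (D.tail e ∉ X ∧ D.head e ∈ X)}

/-- A cut is a non-empty set of edges of the form `D[X, Xᶜ]`. -/
def IsCut (D : MultiDigraph.{u, v}) (S : Set D.E) : Prop :=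
  S.Nonempty ∧ ∃ X : Set D.V, S = D.cutSet X

/-- A bond is a cut that contains no other cut properly. -/
def IsBond (D : MultiDigraph.{u, v}) (S : Set D.E) : Prop :=
  D.IsCut S ∧ ∀ T : Set D.E, D.IsCut T → ¬ T ⊂ S

/-- A directed bond is a bond of the form `D[X, Xᶜ]` such that no edge has its tail in `Xᶜ` and its
head in `X`. -/
def IsDirectedBond (D : MultiDigraph.{u, v}) (S : Set D.E) : Prop :=
  D.IsBond S ∧ ∃ X : Set D.V, S = D.cutSet X ∧ ∀ e : D.E, ¬ (D.tail e ∉ X ∧ D.head e ∈ X)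

/-- An odd dijoin meets every directed bond in an odd number of edges. -/
def IsOddDijoin (D : MultiDigraph.{u, v}) (J : Set D.E) : Prop :=
  ∀ S : Set D.E, D.IsDirectedBond S → Odd (J ∩ S).ncard

/-- The contraction `D / A`: the edges in `A` are deleted, and each weak component of the
subgraph formed by `A` is identified to one vertex. (`Quot` divides by the equivalence relation
generated by the given relation.) For `A = {e}` this is the contraction of the single edge `e`. -/
def contract (D : MultiDigraph.{u, v}) (A : Set D.E) : MultiDigraph.{u, v} where
  V := Quot (fun x y : D.V => ∃ e ∈ A, D.tail e = x ∧ D.head e = y)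
  E := {e : D.E // e ∉ A}
  tail e := Quot.mk _ (D.tail e.1)
  head e := Quot.mk _ (D.head e.1)

/-- The deletion of an edge. -/
def deleteEdge (D : MultiDigraph.{u, v}) (e : D.E) : MultiDigraph.{u, v} where
  V := D.V
  E := {f : D.E // f ≠ e}
  tail f := D.tail f.1
  head f := D.head f.1

/-- An edge is deletable if it is not a loop and there is a directed path from its tail to its head
that does not use it. -/
def IsDeletable (D : MultiDigraph.{u, v}) (e : D.E) : Prop :=
  D.tail e ≠ D.head e ∧
    Relation.ReflTransGen (fun x y : D.V => ∃ f : D.E, f ≠ e ∧ D.tail f = x ∧ D.head f = y)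
      (D.tail e) (D.head e)

/-- A vertex is isolated if no edge is incident with it. -/
def IsIsolated (D : MultiDigraph.{u, v}) (x : D.V) : Prop :=
  ∀ e : D.E, D.tail e ≠ x ∧ D.head e ≠ x

/-- The deletion of an isolated vertex. -/
def deleteIsolated (D : MultiDigraph.{u, v}) (x : D.V) (hx : D.IsIsolated x) :
    MultiDigraph.{u, v} where
  V := {y : D.V // y ≠ x}
  E := D.E
  tail e := ⟨D.tail e, (hx e).1⟩
  head e := ⟨D.head e, (hx e).2⟩

/-- `CutMinorStep D D'`: the digraph `D'` arises from `D` by one cut minor operation, or is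
isomorphic to `D`. -/
inductive CutMinorStep : MultiDigraph.{u, v} → MultiDigraph.{u, v} → Prop
  | iso (D D' : MultiDigraph.{u, v}) (h : Nonempty (Iso D D')) : CutMinorStep D D'
  | contract (D : MultiDigraph.{u, v}) (A : Set D.E) : CutMinorStep D (D.contract A)
  | deleteEdge (D : MultiDigraph.{u, v}) (e : D.E) (he : D.IsDeletable e) :
      CutMinorStep D (D.deleteEdge e)
  | deleteIsolated (D : MultiDigraph.{u, v}) (x : D.V) (hx : D.IsIsolated x) :
      CutMinorStep D (D.deleteIsolated x hx)

/-- `IsCutMinor D₁ D₂`: the digraph `D₁` is a cut minor of `D₂`, that is, it can be obtained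
from `D₂` (up to isomorphism) by finitely many contractions, deletions of deletable edges and
deletions of isolated vertices. -/
def IsCutMinor (D₁ D₂ : MultiDigraph.{u, v}) : Prop :=
  Relation.ReflTransGen CutMinorStep D₂ D₁

/-- The complete bipartite graph with classes of sizes `m` and `n`, all edges oriented from the
first class to the second one. -/
def oneDirection (m n : ℕ) : MultiDigraph.{0, 0} where
  V := Fin m ⊕ Fin n
  E := Fin m × Fin n
  tail e := Sum.inl e.1
  head e := Sum.inr e.2

/-- The digraph with vertices `x₁, …, xₙ` and two hubs, in which `xᵢ` sends one edge to each hub if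
`out i` is true, and receives one edge from each hub otherwise. -/
def diamond (n : ℕ) (out : Fin n → Bool) : MultiDigraph.{0, 0} where
  V := Fin n ⊕ Fin 2
  E := Fin n × Fin 2
  tail e := if out e.1 then Sum.inl e.1 else Sum.inr e.2
  head e := if out e.1 then Sum.inr e.2 else Sum.inl e.1

/-- A one-direction with an odd number of vertices. -/
def IsOddOneDirection (D : MultiDigraph.{u, v}) : Prop :=
  (∃ m n : ℕ, 2 ≤ m ∧ 2 ≤ n ∧ Nonempty (Iso D (oneDirection m n))) ∧ Odd (Nat.card D.V)

/-- A diamond with an odd number of vertices. -/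
def IsOddDiamond (D : MultiDigraph.{u, v}) : Prop :=
  (∃ (n : ℕ) (out : Fin n → Bool), 3 ≤ n ∧ Nonempty (Iso D (diamond n out))) ∧
    Odd (Nat.card D.V)

end MultiDigraph

/-! An odd dijoin is the same as an edge weighting `j` with values in `ZMod 2` that sums to 1 on
every directed bond, and linear algebra over `ZMod 2` applies to such weightings.

Necessity. Odd weightings pass to cut minors. Contractions and deletions of isolated vertices only
select the cuts that survive. For a deletable edge `e`, adding a multiple of the cycle formed by `e`
and its bypass changes no cut sum and makes the weight of `e` zero. Double counting shows that odd
diamonds and odd one-directions have no odd weighting: modulo two, the sum over a cut is the sum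
over the stars of the vertices on one side.

Sufficiency. Take `D` without an odd weighting such that every smaller cut minor has one
(`IsMinimal`). Then `D` is acyclic, connected, has no parallel edges, and every vertex star is a
bond. For a nonempty edge set `A`, contracting `A` yields a weighting that is odd on all directed
bonds avoiding `A`. Call a vertex set lower if no edge enters it; there are two cases.

If, for some lower `P`, no weighting is odd on all directed bonds inside the cut of `P`, then that
cut contains every edge. All edges go from `P` to its complement, and parity counts force all pairs
to be adjacent and the number of vertices to be odd: an odd one-direction (`isOddOneDirection`).

Otherwise each lower `X` has a well-defined parity `f X`, the number modulo two of directed bonds in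
a decomposition of its cut (`IsParity`). If `f` were modular on lower sets, it would come from a
vertex weighting, which is the boundary of an odd edge weighting. So some pair of lower sets
violates modularity (`IsDefect`), and by minimality of `D` every edge lies in one of their two cuts.
A closest such pair has the form `insert u N`, `insert v N`; the vertices `u` and `v` are the hubs
of an odd diamond (`isOddDiamond`). -/

/-- The sum modulo two of the values of `j` on `S`. -/
noncomputable def ZMod.total {α : Type*} (j : α → ZMod 2) (S : Set α) : ZMod 2 :=
  ∑ᶠ a ∈ S, j a

/-! ### Sums modulo two over sets -/

namespace ZMod

section Total

variable {α β : Type*}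

open Classical in
theorem total_eq_sum [Fintype α] (j : α → ZMod 2) (S : Set α) :
    total j S = ∑ a, if a ∈ S then j a else 0 := by
  rw [total, finsum_mem_def, finsum_eq_sum_of_fintype]
  exact Finset.sum_congr rfl fun a _ => by simp [Set.indicator_apply]

@[simp] theorem total_empty (j : α → ZMod 2) : total j ∅ = 0 := by simp [total]

@[simp] theorem total_singleton (j : α → ZMod 2) (a : α) : total j {a} = j a := by simp [total]

theorem total_congr {j j' : α → ZMod 2} {S : Set α} (h : ∀ a ∈ S, j a = j' a) :
    total j S = total j' S :=
  finsum_mem_congr rfl h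

theorem total_image (j : β → ZMod 2) {ι : α → β} (hι : Function.Injective ι) (S : Set α) :
    total j (ι '' S) = total (j ∘ ι) S :=
  finsum_mem_image hι.injOn

variable [Finite α]

theorem total_union (j : α → ZMod 2) {S T : Set α} (h : Disjoint S T) :
    total j (S ∪ T) = total j S + total j T :=
  finsum_mem_union h S.toFinite T.toFinite

theorem total_union_add_inter (j : α → ZMod 2) (S T : Set α) :
    total j (S ∪ T) + total j (S ∩ T) = total j S + total j T :=
  finsum_mem_union_inter S.toFinite T.toFinite

theorem total_add (j j' : α → ZMod 2) (S : Set α) : total (j + j') S = total j S + total j' S :=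
  finsum_mem_add_distrib S.toFinite

theorem total_mul_left (c : ZMod 2) (j : α → ZMod 2) (S : Set α) :
    total (fun a => c * j a) S = c * total j S := by
  classical
  have := Fintype.ofFinite α
  simp only [total_eq_sum, Finset.mul_sum, mul_ite, mul_zero]

theorem total_one (S : Set α) : total (fun _ => 1) S = S.ncard := by
  classical
  have := Fintype.ofFinite α
  rw [total_eq_sum, Finset.sum_boole, Set.ncard_eq_toFinset_card']
  congr 2
  ext; simp

theorem total_add_compl (j : α → ZMod 2) (S : Set α) :
    total j S + total j Sᶜ = total j Set.univ := by
  rw [← total_union j disjoint_compl_right, Set.union_compl_self]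

theorem total_indicator (J S : Set α) : total (J.indicator 1) S = (J ∩ S).ncard := by
  rw [← total_one, total, total, finsum_mem_def, finsum_mem_def, Set.indicator_indicator,
    Set.inter_comm]
  rfl

theorem total_sdiff_singleton (j : α → ZMod 2) {a : α} (h : j a = 0) (S : Set α) :
    total j (S \ {a}) = total j S := by
  by_cases ha : a ∈ S
  · conv_rhs => rw [← Set.sdiff_union_of_subset (Set.singleton_subset_iff.2 ha)]
    rw [total_union _ Set.disjoint_sdiff_left]
    simp [h]
  · rw [Set.sdiff_singleton_eq_self ha]

end Total

theorem eq_one_of_ne_zero {a : ZMod 2} (h : a ≠ 0) : a = 1 := by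
  revert a; decide

end ZMod

open ZMod (total)

namespace MultiDigraph

/-! ### Cuts, lower sets and odd weightings -/

section Basic

variable {D : MultiDigraph.{u, v}}

theorem mem_cutSet {X : Set D.V} {e : D.E} :
    e ∈ D.cutSet X ↔ ¬ (D.tail e ∈ X ↔ D.head e ∈ X) := by
  simp only [cutSet, Set.mem_ofPred_eq]; tauto

@[simp] theorem cutSet_empty : D.cutSet ∅ = ∅ := by ext e; simp [mem_cutSet]

theorem cutSet_compl (X : Set D.V) : D.cutSet Xᶜ = D.cutSet X := by
  ext e; simp only [mem_cutSet, Set.mem_compl_iff]; tauto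

/-- No edge enters the set `X`. -/
def IsLower (D : MultiDigraph.{u, v}) (X : Set D.V) : Prop :=
  ∀ e, D.head e ∈ X → D.tail e ∈ X

theorem IsLower.union {X Y : Set D.V} (hX : D.IsLower X) (hY : D.IsLower Y) :
    D.IsLower (X ∪ Y) :=
  fun e he => he.imp (hX e) (hY e)

theorem IsLower.inter {X Y : Set D.V} (hX : D.IsLower X) (hY : D.IsLower Y) :
    D.IsLower (X ∩ Y) :=
  fun e he => ⟨hX e he.1, hY e he.2⟩

theorem IsLower.mem_cutSet_iff {X : Set D.V} (hX : D.IsLower X) {e : D.E} :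
    e ∈ D.cutSet X ↔ D.tail e ∈ X ∧ D.head e ∉ X := by
  have := hX e
  rw [MultiDigraph.mem_cutSet]; tauto

theorem isDirectedBond_iff {S : Set D.E} :
    D.IsDirectedBond S ↔ D.IsBond S ∧ ∃ X, S = D.cutSet X ∧ D.IsLower X := by
  refine and_congr_right fun _ => exists_congr fun X => and_congr_right fun _ =>
    forall_congr' fun e => ?_
  tauto

theorem isLower_of_cutSet_eq_empty {X : Set D.V} (h : D.cutSet X = ∅) : D.IsLower X := by
  intro e he
  by_contra hc
  have : e ∈ D.cutSet X := Or.inr ⟨hc, he⟩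
  simp [h] at this

theorem IsBond.eq_of_subset {S : Set D.E} (hS : D.IsBond S) {X : Set D.V}
    (hne : (D.cutSet X).Nonempty) (hX : D.cutSet X ⊆ S) : D.cutSet X = S := by
  by_contra hc
  exact hS.2 _ ⟨hne, X, rfl⟩ (hX.ssubset_of_ne hc)

/-- `D` has a weighting of its edges modulo two for which all directed bonds are odd. -/
def HasOddWeighting (D : MultiDigraph.{u, v}) : Prop :=
  ∃ j : D.E → ZMod 2, ∀ S, D.IsDirectedBond S → total j S = 1

theorem exists_isOddDijoin_iff [Finite D.E] :
    (∃ J : Set D.E, D.IsOddDijoin J) ↔ D.HasOddWeighting := by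
  constructor
  · rintro ⟨J, hJ⟩
    refine ⟨J.indicator 1, fun S hS => ?_⟩
    rw [ZMod.total_indicator, ZMod.natCast_eq_one_iff_odd]
    exact hJ S hS
  · rintro ⟨j, hj⟩
    refine ⟨{e | j e = 1}, fun S hS => ?_⟩
    rw [← ZMod.natCast_eq_one_iff_odd, ← ZMod.total_indicator]
    refine Eq.trans ?_ (hj S hS)
    refine ZMod.total_congr fun e _ => ?_
    by_cases h : j e = 1
    · rw [Set.indicator_of_mem (by exact h), h, Pi.one_apply]
    · rw [Set.indicator_of_notMem (by exact h)]
      by_contra hc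
      exact h (ZMod.eq_one_of_ne_zero (Ne.symm hc))

open Classical in
theorem total_cutSet_eq_sum [Fintype D.E] (j : D.E → ZMod 2) (X : Set D.V) :
    total j (D.cutSet X) =
      ∑ e, j e * ((if D.tail e ∈ X then 1 else 0) + if D.head e ∈ X then 1 else 0) := by
  rw [ZMod.total_eq_sum]
  refine Finset.sum_congr rfl fun e _ => ?_
  have h2 : (1 + 1 : ZMod 2) = 0 := by decide
  by_cases h : D.tail e ∈ X <;> by_cases h' : D.head e ∈ X <;> simp [mem_cutSet, h, h', h2]

/-- Summing the stars of the vertices in `X` counts an edge inside `X` twice, hence not at all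
modulo two. In particular cut sums are modular in the vertex set, with no condition on the edges
between the two sets. -/
theorem total_cutSet [Finite D.V] [Finite D.E] (j : D.E → ZMod 2) (X : Set D.V) :
    total j (D.cutSet X) = total (fun x => total j (D.cutSet {x})) X := by
  classical
  have := Fintype.ofFinite D.V
  have := Fintype.ofFinite D.E
  simp only [total_cutSet_eq_sum, ZMod.total_eq_sum (α := D.V)]
  simp only [← Finset.sum_filter]
  rw [Finset.sum_comm]
  refine Finset.sum_congr rfl fun e _ => ?_
  simp [← Finset.mul_sum, Finset.sum_add_distrib]

theorem total_cutSet_union_add_inter [Finite D.V] [Finite D.E] (j : D.E → ZMod 2)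
    (X Y : Set D.V) :
    total j (D.cutSet (X ∪ Y)) + total j (D.cutSet (X ∩ Y)) =
      total j (D.cutSet X) + total j (D.cutSet Y) := by
  rw [total_cutSet j (X ∪ Y), total_cutSet j (X ∩ Y), total_cutSet j X, total_cutSet j Y,
    ZMod.total_union_add_inter]

end Basic

/-! ### Transfer of directed bonds along contractions, isolated vertices and isomorphisms -/

section Transfer

variable {D : MultiDigraph.{u, v}} {D' : MultiDigraph.{u', v'}}

/-- An embedding of edge sets for which the cuts of `D'` are the cuts of `D` inside its range. -/
structure IsCutEmbedding (D : MultiDigraph.{u, v}) (D' : MultiDigraph.{u', v'})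
    (ι : D'.E → D.E) : Prop where
  injective : Function.Injective ι
  exists_image : ∀ X', ∃ X, D.cutSet X = ι '' D'.cutSet X' ∧ (D'.IsLower X' → D.IsLower X)
  exists_preimage : ∀ X, D.cutSet X ⊆ Set.range ι →
    ∃ X', D.cutSet X = ι '' D'.cutSet X' ∧ (D.IsLower X → D'.IsLower X')

theorem IsCutEmbedding.isDirectedBond_image_iff {ι : D'.E → D.E} (h : IsCutEmbedding D D' ι)
    {S : Set D'.E} : D.IsDirectedBond (ι '' S) ↔ D'.IsDirectedBond S := by
  have hcut : ∀ T, D.IsCut (ι '' T) ↔ D'.IsCut T := by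
    intro T
    refine and_congr Set.image_nonempty ⟨?_, ?_⟩
    · rintro ⟨X, hX⟩
      obtain ⟨X', hX', -⟩ := h.exists_preimage X (hX ▸ Set.image_subset_range ι T)
      exact ⟨X', h.injective.image_injective (hX.trans hX')⟩
    · rintro ⟨X', rfl⟩
      obtain ⟨X, hX, -⟩ := h.exists_image X'
      exact ⟨X, hX.symm⟩
  rw [isDirectedBond_iff, isDirectedBond_iff]
  refine and_congr (and_congr (hcut S) ⟨fun hT T hT' hs => ?_, fun hT T hT' hs => ?_⟩) ⟨?_, ?_⟩
  · exact hT _ ((hcut T).2 hT') ((h.injective.image_strictMono hs))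
  · obtain ⟨T, rfl⟩ := Set.subset_range_iff_exists_image_eq.1
      (hs.subset.trans (Set.image_subset_range ι S))
    exact hT _ ((hcut T).1 hT') (⟨(Set.image_subset_image_iff h.injective).1 hs.subset,
      fun hc => hs.not_subset (Set.image_mono hc)⟩)
  · rintro ⟨X, hX, hl⟩
    obtain ⟨X', hX', hl'⟩ := h.exists_preimage X (hX ▸ Set.image_subset_range ι S)
    exact ⟨X', h.injective.image_injective (hX.trans hX'), hl' hl⟩
  · rintro ⟨X', rfl, hl'⟩
    obtain ⟨X, hX, hl⟩ := h.exists_image X'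
    exact ⟨X, hX.symm, hl hl'⟩

theorem IsCutEmbedding.hasOddWeighting {ι : D'.E → D.E} (h : IsCutEmbedding D D' ι)
    (hD : D.HasOddWeighting) : D'.HasOddWeighting := by
  obtain ⟨j, hj⟩ := hD
  refine ⟨j ∘ ι, fun S hS => ?_⟩
  rw [← ZMod.total_image j h.injective]
  exact hj _ (h.isDirectedBond_image_iff.2 hS)

theorem IsCutEmbedding.exists_weighting {ι : D'.E → D.E} (h : IsCutEmbedding D D' ι)
    (hD : D'.HasOddWeighting) :
    ∃ j : D.E → ZMod 2, ∀ S, D.IsDirectedBond S → S ⊆ Set.range ι → total j S = 1 := by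
  obtain ⟨j, hj⟩ := hD
  -- The value 0 off the range is immaterial, since only bonds inside the range are tested.
  refine ⟨Function.extend ι j 0, fun S hS hr => ?_⟩
  obtain ⟨T, rfl⟩ := Set.subset_range_iff_exists_image_eq.1 hr
  rw [ZMod.total_image _ h.injective, ← hj T (h.isDirectedBond_image_iff.1 hS)]
  exact ZMod.total_congr fun e _ => h.injective.extend_apply _ _ _

/-- A cut that avoids `A` does not separate the ends of any edge of `A`, so its side is a union of
fibres of the quotient map. -/
theorem isCutEmbedding_contract (D : MultiDigraph.{u, v}) (A : Set D.E) :
    IsCutEmbedding D (D.contract A) Subtype.val where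
  injective := Subtype.val_injective
  exists_image X' := by
    refine ⟨{x | Quot.mk _ x ∈ X'}, ?_, fun h e he => ?_⟩
    · ext e
      constructor
      · intro he
        refine ⟨⟨e, fun heA => ?_⟩, he, rfl⟩
        rw [mem_cutSet] at he
        refine he ?_
        simp only [Set.mem_ofPred_eq]
        rw [Quot.sound (⟨e, heA, rfl, rfl⟩ : ∃ f ∈ A, D.tail f = D.tail e ∧ D.head f = D.head e)]
      · rintro ⟨e, he, rfl⟩
        exact he
    · by_cases heA : e ∈ A
      · simp only [Set.mem_ofPred_eq] at he ⊢
        rwa [Quot.sound (⟨e, heA, rfl, rfl⟩ :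
          ∃ f ∈ A, D.tail f = D.tail e ∧ D.head f = D.head e)]
      · exact h ⟨e, heA⟩ he
  exists_preimage X hX := by
    have hA : ∀ e ∈ A, D.tail e ∈ X ↔ D.head e ∈ X := by
      intro e he
      by_contra hc
      obtain ⟨f, rfl⟩ := hX (mem_cutSet.2 hc)
      exact f.2 he
    let p : Quot (fun x y : D.V => ∃ e ∈ A, D.tail e = x ∧ D.head e = y) → Prop :=
      Quot.lift (· ∈ X) (by
        rintro _ _ ⟨e, he, rfl, rfl⟩
        exact propext (hA e he))
    refine ⟨{q | p q}, ?_, fun h e he => h e.1 he⟩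
    ext e
    constructor
    · intro he
      exact ⟨⟨e, fun heA => mem_cutSet.1 he (hA e heA)⟩, he, rfl⟩
    · rintro ⟨e, he, rfl⟩
      exact he

theorem isCutEmbedding_deleteIsolated (D : MultiDigraph.{u, v}) (x : D.V) (hx : D.IsIsolated x) :
    IsCutEmbedding D (D.deleteIsolated x hx) (fun e => e) where
  injective _ _ h := h
  exists_image X' := by
    have hmem : ∀ y (hy : y ≠ x), (∃ z ∈ X', Subtype.val z = y) ↔ ⟨y, hy⟩ ∈ X' :=
      fun y hy => ⟨fun ⟨z, hz, hzy⟩ => (Subtype.ext hzy : z = ⟨y, hy⟩) ▸ hz,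
        fun h => ⟨_, h, rfl⟩⟩
    refine ⟨{y | ∃ z ∈ X', Subtype.val z = y}, ?_, fun h e he => ?_⟩
    · ext e
      have h1 := hmem _ (hx e).1
      have h2 := hmem _ (hx e).2
      rw [mem_cutSet]
      refine (not_congr (iff_congr h1 h2)).trans ?_
      exact ⟨fun h => ⟨e, mem_cutSet.2 h, rfl⟩, by rintro ⟨_, h, rfl⟩; exact mem_cutSet.1 h⟩
    · exact (hmem _ (hx e).1).2 (h e ((hmem _ (hx e).2).1 he))
  exists_preimage X _ := by
    refine ⟨{y | y.1 ∈ X}, ?_, fun h e he => h e he⟩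
    ext e
    exact ⟨fun h => ⟨e, h, rfl⟩, by rintro ⟨_, h, rfl⟩; exact h⟩

theorem Iso.isCutEmbedding (φ : Iso D' D) : IsCutEmbedding D D' φ.edge where
  injective := φ.edge.injective
  exists_image X' := by
    refine ⟨φ.vert.symm ⁻¹' X', ?_, fun h e he => ?_⟩
    · ext e
      obtain ⟨e, rfl⟩ := φ.edge.surjective e
      rw [φ.edge.injective.mem_set_image, mem_cutSet, mem_cutSet]
      simp [φ.tail_eq, φ.head_eq]
    · obtain ⟨e, rfl⟩ := φ.edge.surjective e
      simp only [Set.mem_preimage, φ.tail_eq, φ.head_eq, Equiv.symm_apply_apply] at he ⊢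
      exact h e he
  exists_preimage X _ := by
    refine ⟨φ.vert ⁻¹' X, ?_, fun h e he => ?_⟩
    · ext e
      obtain ⟨e, rfl⟩ := φ.edge.surjective e
      rw [φ.edge.injective.mem_set_image, mem_cutSet, mem_cutSet]
      simp [φ.tail_eq, φ.head_eq]
    · simp only [Set.mem_preimage, ← φ.tail_eq, ← φ.head_eq] at he ⊢
      exact h _ he

/-- The inverse of an isomorphism. -/
def Iso.symm (φ : Iso D D') : Iso D' D where
  vert := φ.vert.symm
  edge := φ.edge.symm
  tail_eq e := by
    obtain ⟨e, rfl⟩ := φ.edge.surjective e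
    simp [φ.tail_eq]
  head_eq e := by
    obtain ⟨e, rfl⟩ := φ.edge.surjective e
    simp [φ.head_eq]

end Transfer

/-! ### Deletable edges -/

section Deletion

variable {D : MultiDigraph.{u, v}}

open Classical in
/-- A directed walk, taken modulo two, has boundary `x + y`, and it crosses no directed cut that
does not separate `x` from `y`. -/
theorem exists_chain [Finite D.E] {e : D.E} {x y : D.V}
    (h : Relation.ReflTransGen (fun x y : D.V => ∃ f : D.E, f ≠ e ∧ D.tail f = x ∧ D.head f = y)
      x y) :
    ∃ p : D.E → ZMod 2, p e = 0 ∧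
      (∀ X, (∀ f, f ≠ e → D.head f ∈ X → D.tail f ∈ X) → (y ∈ X → x ∈ X) ∧
        ((x ∈ X → y ∈ X) → ∀ f ∈ D.cutSet X, p f = 0)) ∧
      ∀ X, total p (D.cutSet X) = (if x ∈ X then 1 else 0) + if y ∈ X then 1 else 0 := by
  have := Fintype.ofFinite D.E
  have h2 : (1 + 1 : ZMod 2) = 0 := by decide
  induction h with
  | refl =>
    refine ⟨0, rfl, fun X hX => ⟨id, fun _ _ _ => rfl⟩, fun X => ?_⟩
    rw [ZMod.total_eq_sum]
    split_ifs <;> simp [h2]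
  | tail _ hf ih =>
    obtain ⟨p, hpe, hp, hpX⟩ := ih
    obtain ⟨f, hfe, rfl, rfl⟩ := hf
    refine ⟨p + Pi.single f 1, ?_, fun X hX => ⟨fun hy => (hp X hX).1 (hX f hfe hy), ?_⟩,
      fun X => ?_⟩
    · simp [hpe, Pi.single_eq_of_ne hfe.symm]
    · intro hxy g hg
      have h1 := hp X hX
      have h3 := hX f hfe
      have h4 : g ≠ f := by
        rintro rfl
        rw [mem_cutSet] at hg
        tauto
      have := h1.2 (by tauto) g hg
      simp [this, Pi.single_eq_of_ne h4]
    · rw [ZMod.total_add, hpX, ZMod.total_eq_sum (Pi.single f 1)]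
      have : ∀ g, (if g ∈ D.cutSet X then (Pi.single f 1 : D.E → ZMod 2) g else 0) =
          if g = f then (if f ∈ D.cutSet X then 1 else 0) else 0 := by
        intro g
        by_cases hg : g = f
        · subst hg; simp
        · simp [hg]
      rw [Finset.sum_congr rfl fun g _ => this g]
      simp only [Finset.sum_ite_eq', Finset.mem_univ, if_true, mem_cutSet]
      by_cases ha : D.tail f ∈ X <;> by_cases hb : D.head f ∈ X <;> simp [ha, hb, h2, add_assoc]

/-- The edges of `D.deleteEdge e` as edges of `D`. -/
def deleteEdgeEmb (D : MultiDigraph.{u, v}) (e : D.E) (f : (D.deleteEdge e).E) : D.E := f.1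

theorem deleteEdgeEmb_injective (e : D.E) : Function.Injective (D.deleteEdgeEmb e) :=
  Subtype.val_injective

theorem deleteEdge_image_cutSet (e : D.E) (X : Set D.V) (X' : Set (D.deleteEdge e).V)
    (h : ∀ x : D.V, x ∈ X' ↔ x ∈ X) :
    D.deleteEdgeEmb e '' (D.deleteEdge e).cutSet X' = D.cutSet X \ {e} := by
  ext f
  constructor
  · rintro ⟨f, hf, rfl⟩
    rw [mem_cutSet] at hf
    exact ⟨mem_cutSet.2 fun hc => hf ((h _).trans (hc.trans (h _).symm)), f.2⟩
  · rintro ⟨hf, hfe⟩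
    rw [mem_cutSet] at hf
    exact ⟨⟨f, hfe⟩, mem_cutSet.2 fun hc => hf ((h _).symm.trans (hc.trans (h _))), rfl⟩

theorem deleteEdge_isLower_iff [Finite D.E] {e : D.E} (he : D.IsDeletable e) (X : Set D.V)
    (X' : Set (D.deleteEdge e).V) (h : ∀ x : D.V, x ∈ X' ↔ x ∈ X) :
    (D.deleteEdge e).IsLower X' ↔ D.IsLower X := by
  refine ⟨fun hl f hf => ?_, fun hl f hf => (h _).2 (hl f.1 ((h _).1 hf))⟩
  by_cases hfe : f = e
  · subst hfe
    obtain ⟨p, -, hp, -⟩ := exists_chain he.2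
    exact (hp X fun g hg hX => (h _).1 (hl ⟨g, hg⟩ ((h _).2 hX))).1 hf
  · exact (h _).1 (hl ⟨f, hfe⟩ ((h _).2 hf))

theorem deleteEdge_exists_image [Finite D.E] {e : D.E} (he : D.IsDeletable e)
    (X' : Set (D.deleteEdge e).V) :
    ∃ X : Set D.V, D.deleteEdgeEmb e '' (D.deleteEdge e).cutSet X' = D.cutSet X \ {e} ∧
      ((D.deleteEdge e).IsLower X' ↔ D.IsLower X) :=
  ⟨{x : D.V | x ∈ X'}, deleteEdge_image_cutSet e _ _ fun _ => Iff.rfl,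
    deleteEdge_isLower_iff he _ _ fun _ => Iff.rfl⟩

theorem deleteEdge_exists_preimage [Finite D.E] {e : D.E} (he : D.IsDeletable e) (X : Set D.V) :
    ∃ X' : Set (D.deleteEdge e).V,
      D.deleteEdgeEmb e '' (D.deleteEdge e).cutSet X' = D.cutSet X \ {e} ∧
      ((D.deleteEdge e).IsLower X' ↔ D.IsLower X) :=
  ⟨{x : (D.deleteEdge e).V | x ∈ X}, deleteEdge_image_cutSet e _ _ fun _ => Iff.rfl,
    deleteEdge_isLower_iff he _ _ fun _ => Iff.rfl⟩

variable [Finite D.E]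

theorem IsDeletable.cutSet_diff_nonempty {e : D.E} (he : D.IsDeletable e) {X : Set D.V}
    (hX : (D.cutSet X).Nonempty) : (D.cutSet X \ {e}).Nonempty := by
  classical
  obtain ⟨p, hpe, -, hp⟩ := exists_chain he.2
  by_contra hc
  rw [Set.not_nonempty_iff_eq_empty, Set.sdiff_eq_empty] at hc
  obtain ⟨f, hf⟩ := hX
  obtain rfl : f = e := hc hf
  have h0 : total p (D.cutSet X) = 0 := by
    rw [Set.eq_singleton_iff_unique_mem.2 ⟨hf, fun g hg => hc hg⟩]
    simpa using hpe
  rw [hp X] at h0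
  rw [mem_cutSet] at hf
  by_cases ha : D.tail f ∈ X <;> by_cases hb : D.head f ∈ X <;> simp [ha, hb] at hf h0

/-- Let `p` be the bypass of `e`. Its sum over any cut tells whether `e` is in the cut, so a cut is
determined by its edges other than `e`. Lowerness of `X` matters in one direction: a directed walk
between two vertices on the same side of a directed cut never crosses it. -/
theorem IsDeletable.isBond_iff {e : D.E} (he : D.IsDeletable e) {X : Set D.V}
    (hX : D.IsLower X) {X' : Set (D.deleteEdge e).V}
    (h : D.deleteEdgeEmb e '' (D.deleteEdge e).cutSet X' = D.cutSet X \ {e}) :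
    (D.deleteEdge e).IsBond ((D.deleteEdge e).cutSet X') ↔ D.IsBond (D.cutSet X) := by
  classical
  obtain ⟨p, hpe, hp1, hp⟩ := exists_chain he.2
  have hinj := D.deleteEdgeEmb_injective e
  have hne : ∀ Z Z', D.deleteEdgeEmb e '' (D.deleteEdge e).cutSet Z' = D.cutSet Z \ {e} →
      (((D.deleteEdge e).cutSet Z').Nonempty ↔ (D.cutSet Z).Nonempty) := by
    intro Z Z' hZ
    rw [← Set.image_nonempty (f := D.deleteEdgeEmb e), hZ]
    exact ⟨fun h => h.mono Set.sdiff_subset, he.cutSet_diff_nonempty⟩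
  have hcr : ∀ Z, total p (D.cutSet Z) = if e ∈ D.cutSet Z then 1 else 0 := by
    intro Z
    have h2 : (1 + 1 : ZMod 2) = 0 := by decide
    rw [hp Z]
    by_cases ha : D.tail e ∈ Z <;> by_cases hb : D.head e ∈ Z <;> simp [mem_cutSet, ha, hb, h2]
  constructor
  · rintro ⟨⟨hS, -⟩, hmin⟩
    refine ⟨⟨(hne X X' h).1 hS, X, rfl⟩, ?_⟩
    rintro _ ⟨hZ, Z, rfl⟩ hs
    obtain ⟨Z', hZ', -⟩ := deleteEdge_exists_preimage he Z
    have hsub : (D.deleteEdge e).cutSet Z' ⊆ (D.deleteEdge e).cutSet X' := by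
      rw [← Set.image_subset_image_iff hinj, hZ', h]
      exact Set.sdiff_subset_sdiff_left hs.subset
    have heq : (D.deleteEdge e).cutSet Z' = (D.deleteEdge e).cutSet X' := by
      by_contra hc
      exact hmin _ ⟨(hne Z Z' hZ').2 hZ, Z', rfl⟩ (hsub.ssubset_of_ne hc)
    have h1 : D.cutSet Z \ {e} = D.cutSet X \ {e} := by
      rw [← hZ', ← h, heq]
    have h2 : total p (D.cutSet Z) = total p (D.cutSet X) := by
      rw [← ZMod.total_sdiff_singleton p hpe (D.cutSet Z), h1,
        ZMod.total_sdiff_singleton p hpe (D.cutSet X)]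
    rw [hcr, hcr] at h2
    have h3 : e ∈ D.cutSet Z ↔ e ∈ D.cutSet X := by
      by_cases ha : e ∈ D.cutSet Z <;> by_cases hb : e ∈ D.cutSet X <;> simp_all
    refine hs.ne (Set.ext fun f => ?_)
    by_cases hf : f = e
    · rw [hf, h3]
    · have := Set.ext_iff.1 h1 f
      simpa [hf] using this
  · rintro ⟨⟨hS, -⟩, hmin⟩
    refine ⟨⟨(hne X X' h).2 hS, X', rfl⟩, ?_⟩
    rintro _ ⟨hZ, Z', rfl⟩ hs
    obtain ⟨Z, hZ', -⟩ := deleteEdge_exists_image he Z'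
    have hs' : D.cutSet Z \ {e} ⊂ D.cutSet X \ {e} := by
      rw [← hZ', ← h]
      exact hinj.image_strictMono hs
    -- A smaller cut after the deletion can only arise from a cut using `e` although `e` is not in
    -- the cut of `X`.
    have h1 : ¬ D.cutSet Z ⊆ D.cutSet X := by
      intro hsub
      refine hmin _ ⟨(hne Z Z' hZ').1 hZ, Z, rfl⟩ (hsub.ssubset_of_ne fun h => ?_)
      rw [h] at hs'
      exact hs'.ne rfl
    have h2 : e ∈ D.cutSet Z ∧ e ∉ D.cutSet X := by
      obtain ⟨f, hf, hfX⟩ := Set.not_subset.1 h1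
      have : f = e := by
        by_contra hfe
        exact hfX (hs'.subset ⟨hf, hfe⟩).1
      exact this ▸ ⟨hf, hfX⟩
    -- The bypass does not cross the cut of `X`, so `p` vanishes on the other edges of the cut of
    -- `Z`; but its sum there should be 1 because `e` is in that cut.
    have h3 : total p (D.cutSet Z) = 0 := by
      rw [← ZMod.total_sdiff_singleton p hpe, ← ZMod.total_empty p]
      rw [ZMod.total_congr (j' := fun _ => 0), ZMod.total_empty]
      · simp [total]
      · intro f hf
        refine ((hp1 X fun f _ => hX f).2 ?_) f (hs'.subset hf).1
        have := h2.2
        rw [mem_cutSet] at this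
        tauto
    rw [hcr, if_pos h2.1] at h3
    exact one_ne_zero h3

theorem IsDeletable.hasOddWeighting_iff {e : D.E} (he : D.IsDeletable e) :
    (D.deleteEdge e).HasOddWeighting ↔ D.HasOddWeighting := by
  classical
  have hinj := D.deleteEdgeEmb_injective e
  constructor
  · rintro ⟨j, hj⟩
    refine ⟨Function.extend (D.deleteEdgeEmb e) j 0, fun S hS => ?_⟩
    obtain ⟨hb, X, rfl, hX⟩ := isDirectedBond_iff.1 hS
    obtain ⟨X', hX', hl⟩ := deleteEdge_exists_preimage he X
    rw [← ZMod.total_sdiff_singleton (a := e), ← hX', ZMod.total_image _ hinj]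
    · rw [← hj ((D.deleteEdge e).cutSet X')
        (isDirectedBond_iff.2 ⟨(he.isBond_iff hX hX').2 hb, X', rfl, hl.2 hX⟩)]
      exact ZMod.total_congr fun f _ => hinj.extend_apply _ _ _
    · rw [Function.extend_apply']
      · rfl
      · rintro ⟨f, hf⟩
        exact f.2 hf
  · rintro ⟨j, hj⟩
    obtain ⟨p, hpe, -, hp⟩ := exists_chain he.2
    have := Fintype.ofFinite D.E
    -- The bypass together with `e` is a cycle modulo two, so it meets every cut evenly.
    let q : D.E → ZMod 2 := p + Pi.single e 1
    have hq : ∀ Z, total q (D.cutSet Z) = 0 := by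
      intro Z
      have h2 : (1 + 1 : ZMod 2) = 0 := by decide
      have hs : ∀ g, (if g ∈ D.cutSet Z then (Pi.single e 1 : D.E → ZMod 2) g else 0) =
          if g = e then (if e ∈ D.cutSet Z then 1 else 0) else 0 := by
        intro g
        by_cases hg : g = e
        · subst hg; simp
        · simp [hg]
      rw [ZMod.total_add, hp, ZMod.total_eq_sum (Pi.single e 1),
        Finset.sum_congr rfl fun g _ => hs g]
      simp only [Finset.sum_ite_eq', Finset.mem_univ, if_true, mem_cutSet]
      by_cases ha : D.tail e ∈ Z <;> by_cases hb : D.head e ∈ Z <;> simp [ha, hb, h2]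
    -- Adding `j e` times the cycle moves the weight of `e` onto the bypass without changing any cut
    -- sum.
    let i : D.E → ZMod 2 := j + fun f => j e * q f
    have hi : i e = 0 := by
      have h2 : ∀ a : ZMod 2, a + a = 0 := by decide
      simp [i, q, hpe, h2]
    refine ⟨i ∘ D.deleteEdgeEmb e, fun S hS => ?_⟩
    obtain ⟨hb, X', rfl, hX⟩ := isDirectedBond_iff.1 hS
    obtain ⟨X, hX', hl⟩ := deleteEdge_exists_image he X'
    rw [hl] at hX
    rw [← ZMod.total_image i hinj, hX', ZMod.total_sdiff_singleton i hi,
      ZMod.total_add, ZMod.total_mul_left, hq, mul_zero, add_zero]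
    exact hj _ (isDirectedBond_iff.2 ⟨(he.isBond_iff hX hX').1 hb, X, rfl, hX⟩)

end Deletion

/-! ### Odd weightings pass to cut minors -/

section CutMinor

variable {D D' : MultiDigraph.{u, v}}

theorem CutMinorStep.finite (h : CutMinorStep D D') (hD : Finite D.V ∧ Finite D.E) :
    Finite D'.V ∧ Finite D'.E := by
  obtain ⟨hV, hE⟩ := hD
  cases h with
  | iso _ h =>
    obtain ⟨φ⟩ := h
    exact ⟨Finite.of_equiv _ φ.vert, Finite.of_equiv _ φ.edge⟩
  | contract A => exact ⟨Quot.finite _, Subtype.finite⟩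
  | deleteEdge e _ => exact ⟨hV, Subtype.finite⟩
  | deleteIsolated x _ => exact ⟨Subtype.finite, hE⟩

theorem CutMinorStep.hasOddWeighting [Finite D.E] (h : CutMinorStep D D')
    (hD : D.HasOddWeighting) : D'.HasOddWeighting := by
  cases h with
  | iso _ h =>
    obtain ⟨φ⟩ := h
    exact φ.symm.isCutEmbedding.hasOddWeighting hD
  | contract A => exact (isCutEmbedding_contract D A).hasOddWeighting hD
  | deleteEdge e he => exact he.hasOddWeighting_iff.2 hD
  | deleteIsolated x hx => exact (isCutEmbedding_deleteIsolated D x hx).hasOddWeighting hD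

theorem IsCutMinor.finite_and_hasOddWeighting (h : D'.IsCutMinor D)
    (hD : Finite D.V ∧ Finite D.E) (hw : D.HasOddWeighting) :
    (Finite D'.V ∧ Finite D'.E) ∧ D'.HasOddWeighting := by
  induction h with
  | refl => exact ⟨hD, hw⟩
  | tail _ hs ih =>
    have := ih.1.2
    exact ⟨hs.finite ih.1, hs.hasOddWeighting ih.2⟩

end CutMinor

/-! ### A criterion for bonds -/

section Bonds

variable {D : MultiDigraph.{u, v}}

theorem mem_iff_of_cutSet_subset {X Z : Set D.V} (h : D.cutSet Z ⊆ D.cutSet X) {e : D.E}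
    (he : D.tail e ∈ X ↔ D.head e ∈ X) : D.tail e ∈ Z ↔ D.head e ∈ Z := by
  by_contra hc
  exact mem_cutSet.1 (h (mem_cutSet.2 hc)) he

/-- A cut is a bond if both sides are connected. -/
theorem isBond_cutSet {X : Set D.V} (x y : D.V) (hne : (D.cutSet X).Nonempty)
    (hX : ∀ Z, D.cutSet Z ⊆ D.cutSet X → ∀ z ∈ X, z ∈ Z ↔ x ∈ Z)
    (hY : ∀ Z, D.cutSet Z ⊆ D.cutSet X → ∀ z ∉ X, z ∈ Z ↔ y ∈ Z) :
    D.IsBond (D.cutSet X) := by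
  refine ⟨⟨hne, X, rfl⟩, ?_⟩
  rintro _ ⟨⟨f, hf⟩, Z, rfl⟩ hs
  have h1 := hX Z hs.subset
  have h2 := hY Z hs.subset
  have key : ∀ e ∈ D.cutSet X, (e ∈ D.cutSet Z ↔ ¬ (x ∈ Z ↔ y ∈ Z)) := by
    rintro e (⟨ht, hh⟩ | ⟨ht, hh⟩) <;> rw [mem_cutSet]
    · rw [h1 _ ht, h2 _ hh]
    · rw [h2 _ ht, h1 _ hh, iff_comm (a := x ∈ Z)]
  have hxy := (key f (hs.subset hf)).1 hf
  exact hs.not_subset fun e he => (key e he).2 hxy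

theorem isDirectedBond_of_isLower_compl {X : Set D.V} (hb : D.IsBond (D.cutSet X))
    (hX : D.IsLower Xᶜ) : D.IsDirectedBond (D.cutSet X) :=
  isDirectedBond_iff.2 ⟨hb, Xᶜ, (cutSet_compl X).symm, hX⟩

end Bonds

/-! ### Odd one-directions and odd diamonds have no odd weighting -/

section Easy

variable {D : MultiDigraph.{u, v}}

theorem isBond_singleton_of_bipartite {P : Set D.V} {x y z : D.V} (hx : x ∈ P) (hy : y ∈ P)
    (hxy : y ≠ x) (hz : z ∉ P)
    (hP : ∀ a ∈ P, ∀ b ∉ P, ∃ e, (D.tail e = a ∧ D.head e = b) ∨ (D.tail e = b ∧ D.head e = a)) :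
    D.IsBond (D.cutSet {x}) := by
  have key : ∀ Z, D.cutSet Z ⊆ D.cutSet {x} → ∀ a ∈ P, a ≠ x → ∀ b ∉ P, (a ∈ Z ↔ b ∈ Z) := by
    intro Z hZ a ha hax b hb
    have hbx : b ≠ x := fun h => hb (h ▸ hx)
    obtain ⟨e, ⟨rfl, rfl⟩ | ⟨rfl, rfl⟩⟩ := hP a ha b hb
    · exact mem_iff_of_cutSet_subset hZ (by simp [hax, hbx])
    · exact (mem_iff_of_cutSet_subset hZ (by simp [hax, hbx])).symm
  refine isBond_cutSet x z ?_ ?_ ?_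
  · have hzx : z ≠ x := fun h => hz (h ▸ hx)
    obtain ⟨e, ⟨rfl, rfl⟩ | ⟨rfl, rfl⟩⟩ := hP x hx z hz
    · exact ⟨e, mem_cutSet.2 (by simp [hzx])⟩
    · exact ⟨e, mem_cutSet.2 (by simp [hzx])⟩
  · rintro Z - a rfl
    rfl
  · intro Z hZ a ha
    have hax : a ≠ x := fun h => ha (by rw [h]; rfl)
    by_cases haP : a ∈ P
    · exact key Z hZ a haP hax z hz
    · exact (key Z hZ y hy hxy a haP).symm.trans (key Z hZ y hy hxy z hz)

theorem total_cutSet_eq_ncard [Finite D.V] [Finite D.E] {j : D.E → ZMod 2} {P : Set D.V}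
    (h : ∀ x ∈ P, total j (D.cutSet {x}) = 1) : total j (D.cutSet P) = P.ncard := by
  rw [total_cutSet, ZMod.total_congr (j' := fun _ => 1) h, ZMod.total_one]

/-- All stars are directed bonds. Summing those of either class gives the total weight, so the two
class sizes have the same parity and the number of vertices is even. -/
theorem not_hasOddWeighting_of_oneDirection [Finite D.V] [Finite D.E] {P : Set D.V}
    (hE : ∀ e, D.tail e ∈ P ∧ D.head e ∉ P)
    (hP : ∀ a ∈ P, ∀ b ∉ P, ∃ e, D.tail e = a ∧ D.head e = b)
    (h1 : P.Nontrivial) (h2 : Pᶜ.Nontrivial) (hodd : Odd (Nat.card D.V)) :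
    ¬ D.HasOddWeighting := by
  rintro ⟨j, hj⟩
  have hP1 : total j (D.cutSet P) = P.ncard := by
    refine total_cutSet_eq_ncard fun x hx => hj _ ?_
    obtain ⟨y, hy, hxy⟩ := h1.exists_ne x
    obtain ⟨z, hz⟩ := h2.nonempty
    refine isDirectedBond_iff.2 ⟨isBond_singleton_of_bipartite hx hy hxy hz fun a ha b hb =>
      (hP a ha b hb).imp fun e he => Or.inl he, _, rfl, fun e he => ?_⟩
    rw [Set.mem_singleton_iff] at he
    exact absurd hx (he ▸ (hE e).2)
  have hP2 : total j (D.cutSet Pᶜ) = Pᶜ.ncard := by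
    refine total_cutSet_eq_ncard fun x hx => hj _ ?_
    obtain ⟨y, hy, hxy⟩ := h2.exists_ne x
    obtain ⟨z, hz⟩ := h1.nonempty
    refine isDirectedBond_of_isLower_compl (isBond_singleton_of_bipartite hx hy hxy
      (fun h => h hz) fun a ha b hb =>
        (hP b (not_not.1 hb) a ha).imp fun e he => Or.inr he) fun e _ => ?_
    rintro rfl
    exact hx (hE e).1
  rw [cutSet_compl, hP1] at hP2
  rw [← Set.ncard_add_ncard_compl P, ← ZMod.natCast_eq_one_iff_odd, Nat.cast_add, hP2] at hodd
  revert hodd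
  generalize (Pᶜ.ncard : ZMod 2) = a
  revert a
  decide

/-- The stars of the oddly many middle vertices partition the edges, so the total weight is 1. Yet
the edges are also partitioned into two directed bonds, with sides `h₁` plus the out-vertices and
`h₂` plus the out-vertices, which gives total weight 0. -/
theorem not_hasOddWeighting_of_diamond [Finite D.V] [Finite D.E] {h₁ h₂ : D.V} (hne : h₁ ≠ h₂)
    {O : Set D.V}
    (hE : ∀ e, (D.tail e ∈ O ∧ D.tail e ∉ ({h₁, h₂} : Set D.V) ∧ D.head e ∈ ({h₁, h₂} : Set D.V)) ∨
      (D.head e ∉ O ∧ D.head e ∉ ({h₁, h₂} : Set D.V) ∧ D.tail e ∈ ({h₁, h₂} : Set D.V)))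
    (hP : ∀ a ∈ ({h₁, h₂} : Set D.V)ᶜ, ∀ b ∉ ({h₁, h₂} : Set D.V)ᶜ,
      ∃ e, (D.tail e = a ∧ D.head e = b) ∨ (D.tail e = b ∧ D.head e = a))
    (hM : ({h₁, h₂} : Set D.V)ᶜ.Nontrivial) (hodd : Odd (({h₁, h₂} : Set D.V)ᶜ.ncard)) :
    ¬ D.HasOddWeighting := by
  rintro ⟨j, hj⟩
  have hc : ∀ h ∈ ({h₁, h₂} : Set D.V), h ∉ ({h₁, h₂} : Set D.V)ᶜ := fun h hh hc => hc hh
  have hM1 : total j (D.cutSet ({h₁, h₂} : Set D.V)ᶜ) = 1 := by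
    rw [total_cutSet_eq_ncard, ZMod.natCast_eq_one_iff_odd.2 hodd]
    intro x hx
    obtain ⟨y, hy, hxy⟩ := hM.exists_ne x
    have hb := isBond_singleton_of_bipartite hx hy hxy (hc h₁ (by simp)) hP
    by_cases hxO : x ∈ O
    · refine hj _ (isDirectedBond_iff.2 ⟨hb, _, rfl, ?_⟩)
      rintro e rfl
      rcases hE e with h | h
      · exact absurd h.2.2 hx
      · exact absurd hxO h.1
    · refine hj _ (isDirectedBond_of_isLower_compl hb ?_)
      rintro e - rfl
      rcases hE e with h | h
      · exact hxO h.1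
      · exact hx h.2.2
  obtain ⟨m, hm⟩ := hM.nonempty
  have hub : ∀ h h' : D.V, h ≠ h' → (∀ x, x ∈ ({h₁, h₂} : Set D.V) ↔ x = h ∨ x = h') →
      D.IsDirectedBond (D.cutSet {x | x = h ∨ (x ≠ h' ∧ x ∈ O)}) := by
    intro h h' hh hH
    have hnb : ∀ x, x ≠ h → x ≠ h' → x ∈ ({h₁, h₂} : Set D.V)ᶜ := by
      intro x hx hx'
      rw [Set.mem_compl_iff, hH]
      tauto
    have hmh : m ≠ h := fun hmh => hm ((hH m).2 (Or.inl hmh))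
    have hmh' : m ≠ h' := fun hmh => hm ((hH m).2 (Or.inr hmh))
    have key : ∀ Z, D.cutSet Z ⊆ D.cutSet {x | x = h ∨ (x ≠ h' ∧ x ∈ O)} →
        ∀ a ∈ ({h₁, h₂} : Set D.V)ᶜ, ∀ b ∈ ({h₁, h₂} : Set D.V),
          ((a = h ∨ (a ≠ h' ∧ a ∈ O)) ↔ (b = h ∨ (b ≠ h' ∧ b ∈ O))) → (a ∈ Z ↔ b ∈ Z) := by
      intro Z hZ a ha b hb hab
      obtain ⟨e, ⟨rfl, rfl⟩ | ⟨rfl, rfl⟩⟩ := hP a ha b (hc b hb)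
      · exact mem_iff_of_cutSet_subset hZ hab
      · exact (mem_iff_of_cutSet_subset hZ hab.symm).symm
    refine isDirectedBond_iff.2 ⟨isBond_cutSet h h' ?_ ?_ ?_, _, rfl, ?_⟩
    · by_contra hemp
      rw [Set.not_nonempty_iff_eq_empty] at hemp
      have hmem : ∀ b ∈ ({h₁, h₂} : Set D.V),
          ((m = h ∨ (m ≠ h' ∧ m ∈ O)) ↔ (b = h ∨ (b ≠ h' ∧ b ∈ O))) := by
        intro b hb
        obtain ⟨e, he⟩ := hP m hm b (hc b hb)
        have : e ∉ D.cutSet {x | x = h ∨ (x ≠ h' ∧ x ∈ O)} := by simp [hemp]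
        rw [mem_cutSet, not_not] at this
        rcases he with ⟨rfl, rfl⟩ | ⟨rfl, rfl⟩
        · exact this
        · exact this.symm
      have a1 := hmem h ((hH h).2 (Or.inl rfl))
      have a2 := hmem h' ((hH h').2 (Or.inr rfl))
      have := hh.symm
      tauto
    · intro Z hZ z hz
      by_cases hzh : z = h
      · rw [hzh]
      · have hz' : z ≠ h' ∧ z ∈ O := hz.resolve_left hzh
        exact key Z hZ z (hnb z hzh hz'.1) h ((hH h).2 (Or.inl rfl)) (by tauto)
    · intro Z hZ z hz
      by_cases hzh : z = h'
      · rw [hzh]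
      · have hz1 : z ≠ h := fun h => hz (Or.inl h)
        have hz2 : z ∉ O := fun h => hz (Or.inr ⟨hzh, h⟩)
        have := hh.symm
        exact key Z hZ z (hnb z hz1 hzh) h' ((hH h').2 (Or.inr rfl)) (by tauto)
    · intro e he
      have he1 := hE e
      rw [hH, hH] at he1
      have : D.head e = h ∨ (D.head e ≠ h' ∧ D.head e ∈ O) := he
      change D.tail e = h ∨ (D.tail e ≠ h' ∧ D.tail e ∈ O)
      tauto
  have hS1 := hub h₁ h₂ hne (by simp)
  have hS2 := hub h₂ h₁ hne.symm (by simp [or_comm])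
  have hS : (D.cutSet {x | x = h₁ ∨ (x ≠ h₂ ∧ x ∈ O)})ᶜ =
      D.cutSet {x | x = h₂ ∨ (x ≠ h₁ ∧ x ∈ O)} := by
    ext e
    have he := hE e
    simp only [Set.mem_insert_iff, Set.mem_singleton_iff] at he
    simp only [Set.mem_compl_iff, mem_cutSet, Set.mem_ofPred_eq]
    have := hne.symm
    rcases he with ⟨h1, h2, h3 | h3⟩ | ⟨h1, h2, h3 | h3⟩ <;> rw [h3] <;> tauto
  have huniv : D.cutSet ({h₁, h₂} : Set D.V)ᶜ = Set.univ := by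
    ext e
    have he := hE e
    simp only [mem_cutSet, Set.mem_compl_iff, Set.mem_univ, iff_true]
    tauto
  have hsum := ZMod.total_add_compl j (D.cutSet {x | x = h₁ ∨ (x ≠ h₂ ∧ x ∈ O)})
  rw [hS, hj _ hS1, hj _ hS2, ← huniv, hM1] at hsum
  revert hsum
  decide

theorem IsOddOneDirection.not_hasOddWeighting [Finite D.V] [Finite D.E]
    (h : D.IsOddOneDirection) : ¬ D.HasOddWeighting := by
  obtain ⟨⟨m, n, hm, hn, ⟨φ⟩⟩, hodd⟩ := h
  obtain ⟨f, g, hf, hf'⟩ : ∃ (f : D.V ≃ Fin m ⊕ Fin n) (g : D.E ≃ Fin m × Fin n),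
      (∀ e, f (D.tail e) = Sum.inl (g e).1) ∧ ∀ e, f (D.head e) = Sum.inr (g e).2 :=
    ⟨φ.vert, φ.edge, fun e => (φ.tail_eq e).symm, fun e => (φ.head_eq e).symm⟩
  have : Nontrivial (Fin m) := Fin.nontrivial_iff_two_le.2 hm
  have : Nontrivial (Fin n) := Fin.nontrivial_iff_two_le.2 hn
  obtain ⟨a, a', ha⟩ := exists_pair_ne (Fin m)
  obtain ⟨b, b', hb⟩ := exists_pair_ne (Fin n)
  have hinj := f.symm.injective
  refine not_hasOddWeighting_of_oneDirection (P := {x | ∃ i, f x = Sum.inl i})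
    (fun e => ?_) ?_ ?_ ?_ hodd
  · refine ⟨⟨_, hf e⟩, ?_⟩
    rintro ⟨i, hi⟩
    rw [hf'] at hi
    exact Sum.inr_ne_inl hi
  · rintro x ⟨i, hi⟩ y hy
    obtain ⟨k, hk⟩ : ∃ k, f y = Sum.inr k := by
      rcases h : f y with i | k
      · exact absurd ⟨i, h⟩ hy
      · exact ⟨k, rfl⟩
    refine ⟨g.symm (i, k), f.injective ?_, f.injective ?_⟩
    · rw [hf, Equiv.apply_symm_apply, hi]
    · rw [hf', Equiv.apply_symm_apply, hk]
  · exact ⟨f.symm (Sum.inl a), ⟨a, f.apply_symm_apply _⟩,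
      f.symm (Sum.inl a'), ⟨a', f.apply_symm_apply _⟩,
      fun h => ha (Sum.inl_injective (hinj h))⟩
  · refine ⟨f.symm (Sum.inr b), ?_, f.symm (Sum.inr b'), ?_,
      fun h => hb (Sum.inr_injective (hinj h))⟩
    · rintro ⟨i, hi⟩
      rw [Equiv.apply_symm_apply] at hi
      exact Sum.inr_ne_inl hi
    · rintro ⟨i, hi⟩
      rw [Equiv.apply_symm_apply] at hi
      exact Sum.inr_ne_inl hi

theorem IsOddDiamond.not_hasOddWeighting [Finite D.V] [Finite D.E] (h : D.IsOddDiamond) :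
    ¬ D.HasOddWeighting := by
  obtain ⟨⟨n, out, hn, ⟨φ⟩⟩, hodd⟩ := h
  obtain ⟨f, g, hf, hf'⟩ : ∃ (f : D.V ≃ Fin n ⊕ Fin 2) (g : D.E ≃ Fin n × Fin 2),
      (∀ e, f (D.tail e) = if out (g e).1 then Sum.inl (g e).1 else Sum.inr (g e).2) ∧
      ∀ e, f (D.head e) = if out (g e).1 then Sum.inr (g e).2 else Sum.inl (g e).1 :=
    ⟨φ.vert, φ.edge, fun e => (φ.tail_eq e).symm, fun e => (φ.head_eq e).symm⟩
  have : Nontrivial (Fin n) := Fin.nontrivial_iff_two_le.2 (by omega)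
  obtain ⟨a, a', ha⟩ := exists_pair_ne (Fin n)
  have hinj := f.symm.injective
  have hhub : ∀ x, x ∈ ({f.symm (Sum.inr 0), f.symm (Sum.inr 1)} : Set D.V) ↔
      ∃ c, f x = Sum.inr c := by
    intro x
    rw [Set.mem_insert_iff, Set.mem_singleton_iff, Equiv.eq_symm_apply, Equiv.eq_symm_apply]
    exact (Fin.exists_fin_two (p := fun c => f x = Sum.inr c)).symm
  have hmid : ∀ x, x ∉ ({f.symm (Sum.inr 0), f.symm (Sum.inr 1)} : Set D.V) ↔
      ∃ i, f x = Sum.inl i := by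
    intro x
    rw [hhub]
    rcases h : f x with i | c
    · exact ⟨fun _ => ⟨i, rfl⟩, fun _ ⟨c, hc⟩ => Sum.inl_ne_inr hc⟩
    · exact ⟨fun h => absurd ⟨c, rfl⟩ h, fun ⟨i, hi⟩ => absurd hi Sum.inr_ne_inl⟩
  have hne : f.symm (Sum.inr 0) ≠ f.symm (Sum.inr 1) := fun h =>
    zero_ne_one (Sum.inr_injective (hinj h))
  refine not_hasOddWeighting_of_diamond hne (O := {x | ∃ i, out i ∧ f x = Sum.inl i})
    (fun e => ?_) ?_ ?_ ?_
  · rw [hmid (D.tail e), hmid (D.head e), hhub, hhub]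
    have ht := hf e
    have hh := hf' e
    cases ho : out (g e).1
    · simp only [ho, Bool.false_eq_true, if_false] at ht hh
      refine Or.inr ⟨?_, ⟨_, hh⟩, ⟨_, ht⟩⟩
      rintro ⟨i, hi, hi'⟩
      rw [hh] at hi'
      have := Sum.inl_injective hi'
      rw [this, hi] at ho
      exact Bool.false_ne_true ho.symm
    · simp only [ho, if_true] at ht hh
      exact Or.inl ⟨⟨_, ho, ht⟩, ⟨_, ht⟩, ⟨_, hh⟩⟩
  · intro x hx y hy
    obtain ⟨i, hi⟩ := (hmid x).1 hx
    obtain ⟨c, hc⟩ := (hhub y).1 (not_not.1 hy)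
    refine ⟨g.symm (i, c), ?_⟩
    have ht := hf (g.symm (i, c))
    have hh := hf' (g.symm (i, c))
    rw [Equiv.apply_symm_apply] at ht hh
    cases ho : out i
    · simp only [ho, Bool.false_eq_true, if_false] at ht hh
      exact Or.inr ⟨f.injective (ht.trans hc.symm),
        f.injective (hh.trans hi.symm)⟩
    · simp only [ho, if_true] at ht hh
      exact Or.inl ⟨f.injective (ht.trans hi.symm),
        f.injective (hh.trans hc.symm)⟩
  · exact ⟨f.symm (Sum.inl a), (hmid _).2 ⟨a, f.apply_symm_apply _⟩,
      f.symm (Sum.inl a'), (hmid _).2 ⟨a', f.apply_symm_apply _⟩,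
      fun h => ha (Sum.inl_injective (hinj h))⟩
  · rw [← Set.ncard_add_ncard_compl ({f.symm (Sum.inr 0), f.symm (Sum.inr 1)} : Set D.V),
      Set.ncard_pair hne, Nat.odd_add'] at hodd
    exact hodd.2 (by decide)

end Easy

/-! ### Decomposing directed cuts into bonds; boundaries of edge weightings -/

section Decomposition

variable {D : MultiDigraph.{u, v}}

/-- A smaller cut with side `Q` divides `X` and its complement into two parts each. Every edge of
the cut of `Q` leads from `X` to the complement, so no edge joins the two parts of `X` or the two
parts of the complement. The cut of `X` therefore splits according to the tail's part, and likewise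
according to the head's part. -/
theorem IsLower.exists_split {X : Set D.V} (hX : D.IsLower X) (hne : (D.cutSet X).Nonempty)
    (hb : ¬ D.IsBond (D.cutSet X)) :
    ∃ Y Z, D.IsLower Y ∧ D.IsLower Z ∧ D.cutSet X = D.cutSet Y ∪ D.cutSet Z ∧
      Disjoint (D.cutSet Y) (D.cutSet Z) ∧ (D.cutSet Y).Nonempty ∧ (D.cutSet Z).Nonempty := by
  have : ∃ Q, (D.cutSet Q).Nonempty ∧ D.cutSet Q ⊂ D.cutSet X := by
    by_contra! hc
    exact hb ⟨⟨hne, X, rfl⟩, by rintro _ ⟨h, Q, rfl⟩; exact hc Q h⟩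
  obtain ⟨Q, ⟨f, hf⟩, hQ⟩ := this
  obtain ⟨g, hgX, hgQ⟩ := Set.exists_of_ssubset hQ
  have hsub : ∀ e, ¬ (D.tail e ∈ Q ↔ D.head e ∈ Q) → D.tail e ∈ X ∧ D.head e ∉ X :=
    fun e he => hX.mem_cutSet_iff.1 (hQ.subset (mem_cutSet.2 he))
  have hmem : ∀ Y : Set D.V, ∀ e ∈ D.cutSet Y, (D.cutSet Y).Nonempty := fun Y e he => ⟨e, he⟩
  have hfX := hsub f (mem_cutSet.1 hf)
  rw [hX.mem_cutSet_iff] at hgX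
  rw [mem_cutSet] at hf hgQ
  by_cases h1 : (D.cutSet (X ∩ Q)).Nonempty ∧ (D.cutSet (X \ Q)).Nonempty
  · refine ⟨X ∩ Q, X \ Q, ?_, ?_, ?_, ?_, h1.1, h1.2⟩
    · intro e he
      have := hX e he.1
      have := hsub e
      simp only [Set.mem_inter_iff] at he ⊢
      grind
    · intro e he
      have := hX e he.1
      have := hsub e
      simp only [Set.mem_sdiff] at he ⊢
      grind
    · ext e
      have := hX e
      have := hsub e
      simp only [Set.mem_union, mem_cutSet, Set.mem_inter_iff, Set.mem_sdiff]
      grind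
    · rw [Set.disjoint_left]
      intro e he he'
      have := hX e
      have := hsub e
      simp only [mem_cutSet, Set.mem_inter_iff, Set.mem_sdiff] at he he'
      grind
  by_cases h2 : (D.cutSet (X ∪ Q)).Nonempty ∧ (D.cutSet (X ∪ Qᶜ)).Nonempty
  · refine ⟨X ∪ Q, X ∪ Qᶜ, ?_, ?_, ?_, ?_, h2.1, h2.2⟩
    · intro e he
      have := hX e
      have := hsub e
      simp only [Set.mem_union] at he ⊢
      grind
    · intro e he
      have := hX e
      have := hsub e
      simp only [Set.mem_union, Set.mem_compl_iff] at he ⊢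
      grind
    · ext e
      have := hX e
      have := hsub e
      simp only [Set.mem_union, mem_cutSet, Set.mem_compl_iff]
      grind
    · rw [Set.disjoint_left]
      intro e he he'
      have := hX e
      have := hsub e
      simp only [mem_cutSet, Set.mem_union, Set.mem_compl_iff] at he he'
      grind
  -- The edge `f` crosses `Q` and `g` does not, so they differ in the part of their tails or in the
  -- part of their heads; accordingly one of the two splittings has nonempty pieces.
  exfalso
  have a1 := hmem (X ∩ Q) f
  have a2 := hmem (X ∩ Q) g
  have b1 := hmem (X \ Q) f
  have b2 := hmem (X \ Q) g
  have c1 := hmem (X ∪ Q) f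
  have c2 := hmem (X ∪ Q) g
  have d1 := hmem (X ∪ Qᶜ) f
  have d2 := hmem (X ∪ Qᶜ) g
  simp only [mem_cutSet, Set.mem_union, Set.mem_compl_iff, Set.mem_inter_iff, Set.mem_sdiff,
    hgX, hfX] at a1 a2 b1 b2 c1 c2 d1 d2
  grind

/-- Every directed cut is a disjoint union of directed bonds, as an induction principle. -/
theorem IsLower.cutSet_induction [Finite D.E] {P : Set D.E → Prop} (empty : P ∅)
    (bond : ∀ S, D.IsDirectedBond S → P S)
    (union : ∀ S T, Disjoint S T → P S → P T → P (S ∪ T)) {X : Set D.V} (hX : D.IsLower X) :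
    P (D.cutSet X) := by
  induction hk : (D.cutSet X).ncard using Nat.strong_induction_on generalizing X with
  | _ k ih =>
    subst hk
    rcases (D.cutSet X).eq_empty_or_nonempty with h0 | hne
    · rwa [h0]
    by_cases hb : D.IsBond (D.cutSet X)
    · exact bond _ (isDirectedBond_iff.2 ⟨hb, X, rfl, hX⟩)
    obtain ⟨Y, Z, hY, hZ, h, hd, hYn, hZn⟩ := hX.exists_split hne hb
    have hc := Set.ncard_union_eq hd (Set.toFinite _) (Set.toFinite _)
    rw [← h] at hc
    have := (Set.ncard_pos (Set.toFinite _)).2 hYn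
    have := (Set.ncard_pos (Set.toFinite _)).2 hZn
    rw [h]
    exact union _ _ hd (ih _ (by omega) hY rfl) (ih _ (by omega) hZ rfl)

/-- The sum is the number of bonds in a decomposition of the cut, whichever weighting is used; this
makes the parity of a directed cut well defined. -/
theorem IsLower.total_congr [Finite D.E] {X : Set D.V} (hX : D.IsLower X) {i j : D.E → ZMod 2}
    (hi : ∀ S, D.IsDirectedBond S → S ⊆ D.cutSet X → total i S = 1)
    (hj : ∀ S, D.IsDirectedBond S → S ⊆ D.cutSet X → total j S = 1) :
    total i (D.cutSet X) = total j (D.cutSet X) := by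
  have : D.cutSet X ⊆ D.cutSet X → total i (D.cutSet X) = total j (D.cutSet X) := by
    refine hX.cutSet_induction (P := fun S => S ⊆ D.cutSet X → total i S = total j S) ?_ ?_ ?_
    · simp
    · exact fun S hS hs => (hi S hS hs).trans (hj S hS hs).symm
    · intro S T hd hS hT hs
      rw [ZMod.total_union _ hd, ZMod.total_union _ hd,
        hS (Set.subset_union_left.trans hs), hT (Set.subset_union_right.trans hs)]
  exact this subset_rfl

theorem IsLower.exists_isDirectedBond [Finite D.E] {X : Set D.V} (hX : D.IsLower X) {e : D.E}
    (he : e ∈ D.cutSet X) : ∃ S, D.IsDirectedBond S ∧ e ∈ S ∧ S ⊆ D.cutSet X := by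
  refine hX.cutSet_induction
    (P := fun T => e ∈ T → ∃ S, D.IsDirectedBond S ∧ e ∈ S ∧ S ⊆ T) ?_ ?_ ?_ he
  · simp
  · exact fun S hS h => ⟨S, hS, h, subset_rfl⟩
  · rintro S T - hS hT (h | h)
    · obtain ⟨R, h1, h2, h3⟩ := hS h
      exact ⟨R, h1, h2, h3.trans Set.subset_union_left⟩
    · obtain ⟨R, h1, h2, h3⟩ := hT h
      exact ⟨R, h1, h2, h3.trans Set.subset_union_right⟩

/-- A function on the vertices is the boundary of a weighting of the edges if it vanishes on all
unions of weak components. -/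
theorem exists_weighting_of_total [Finite D.V] [Finite D.E] (w : D.V → ZMod 2)
    (h : ∀ Z, D.cutSet Z = ∅ → total w Z = 0) :
    ∃ j : D.E → ZMod 2, ∀ X, total j (D.cutSet X) = total w X := by
  classical
  have := Fintype.ofFinite D.V
  have := Fintype.ofFinite D.E
  have h2 : ∀ a b : ZMod 2, a + b = 0 → a = b := by decide
  let b : D.E → D.V → ZMod 2 := fun e => Pi.single (D.tail e) 1 + Pi.single (D.head e) 1
  have hmem : w ∈ Submodule.span (ZMod 2) (Set.range b) := by
    -- Otherwise a linear functional kills all edge boundaries but not `w`. Its support has an empty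
    -- cut, and its value at `w` is the sum of `w` over the support.
    by_contra hw
    obtain ⟨f, hf, hle⟩ := Submodule.exists_le_ker_of_notMem hw
    refine hf ?_
    have hcut : D.cutSet {x | f (Pi.single x 1) = 1} = ∅ := by
      ext e
      have he : f (b e) = 0 := hle (Submodule.subset_span ⟨e, rfl⟩)
      rw [map_add] at he
      simp [mem_cutSet, h2 _ _ he]
    rw [← h _ hcut, LinearMap.pi_apply_eq_sum_univ, ZMod.total_eq_sum]
    refine Finset.sum_congr rfl fun x _ => ?_
    have hx : (fun y => if x = y then (1 : ZMod 2) else 0) = Pi.single x 1 := by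
      ext y
      simp [Pi.single_apply, eq_comm]
    rw [hx, smul_eq_mul]
    by_cases h1 : f (Pi.single x 1) = 0
    · simp [h1]
    · simp [ZMod.eq_one_of_ne_zero h1]
  obtain ⟨j, rfl⟩ := (Submodule.mem_span_range_iff_exists_fun (ZMod 2)).1 hmem
  refine ⟨j, fun X => ?_⟩
  rw [total_cutSet_eq_sum, ZMod.total_eq_sum, ← Finset.sum_filter]
  simp only [Finset.sum_apply, Pi.smul_apply, smul_eq_mul]
  rw [Finset.sum_comm]
  refine Finset.sum_congr rfl fun e _ => ?_
  rw [← Finset.mul_sum]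
  simp [b, Pi.single_apply, Finset.sum_add_distrib]

end Decomposition

/-! ### Structure of minimal digraphs without odd weighting -/

/-- A digraph without odd weighting such that every smaller cut minor has one. -/
structure IsMinimal (D : MultiDigraph.{u, v}) : Prop where
  not_hasOddWeighting : ¬ D.HasOddWeighting
  exists_weighting : ∀ A : Set D.E, A.Nonempty →
    ∃ j : D.E → ZMod 2, ∀ S, D.IsDirectedBond S → Disjoint S A → total j S = 1
  not_isDeletable : ∀ e, ¬ D.IsDeletable e
  not_isIsolated : ∀ x, ¬ D.IsIsolated x

namespace IsMinimal

variable {D : MultiDigraph.{u, v}}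

/-- An edge on a directed closed walk lies in no directed bond, so a weighting obtained by
contracting it would be odd on all directed bonds. -/
theorem acyclic (hD : D.IsMinimal) (e : D.E) :
    ¬ Relation.ReflTransGen (fun x y : D.V => ∃ f : D.E, D.tail f = x ∧ D.head f = y)
      (D.head e) (D.tail e) := by
  intro h
  obtain ⟨j, hj⟩ := hD.exists_weighting {e} (Set.singleton_nonempty e)
  refine hD.not_hasOddWeighting ⟨j, fun S hS => hj S hS ?_⟩
  obtain ⟨-, X, rfl, hX⟩ := isDirectedBond_iff.1 hS
  rw [Set.disjoint_singleton_right, hX.mem_cutSet_iff]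
  have : ∀ x y, Relation.ReflTransGen (fun x y : D.V => ∃ f : D.E, D.tail f = x ∧ D.head f = y) x y →
      y ∈ X → x ∈ X := by
    intro x y hxy
    induction hxy with
    | refl => exact id
    | tail _ hf ih =>
      obtain ⟨f, rfl, rfl⟩ := hf
      exact fun hy => ih (hX f hy)
  exact fun hc => hc.2 (this _ _ h hc.1)

theorem tail_ne_head (hD : D.IsMinimal) (e : D.E) : D.tail e ≠ D.head e :=
  fun h => hD.acyclic e (by rw [h])

theorem eq_of_parallel (hD : D.IsMinimal) {e f : D.E} (ht : D.tail e = D.tail f)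
    (hh : D.head e = D.head f) : e = f := by
  by_contra hc
  exact hD.not_isDeletable e ⟨hD.tail_ne_head e,
    Relation.ReflTransGen.single ⟨f, Ne.symm hc, ht.symm, hh.symm⟩⟩

theorem exists_edge (hD : D.IsMinimal) (x : D.V) : ∃ e, D.tail e = x ∨ D.head e = x := by
  by_contra! h
  exact hD.not_isIsolated x h

/-- A minimal digraph has no separation of order zero or one. -/
theorem not_separation (hD : D.IsMinimal) (F : Set D.E) (h1 : F.Nonempty) (h2 : Fᶜ.Nonempty)
    (hF : ∀ X, ∃ X', D.cutSet X' = D.cutSet X ∩ F) : False := by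
  classical
  obtain ⟨j, hj⟩ := hD.exists_weighting F h1
  obtain ⟨i, hi⟩ := hD.exists_weighting Fᶜ h2
  -- By `hF` every bond lies in `F` or is disjoint from it, so weightings for the two kinds of bonds
  -- can be glued.
  refine hD.not_hasOddWeighting ⟨fun e => if e ∈ F then i e else j e, fun S hS => ?_⟩
  obtain ⟨hb, X, rfl, -⟩ := isDirectedBond_iff.1 hS
  obtain ⟨X', hX'⟩ := hF X
  rcases (D.cutSet X').eq_empty_or_nonempty with h0 | hne
  · have hd : Disjoint (D.cutSet X) F := by
      rw [Set.disjoint_iff_inter_eq_empty, ← hX', h0]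
    rw [← hj _ hS hd]
    exact ZMod.total_congr fun e he => if_neg (Set.disjoint_left.1 hd he)
  · have hs : D.cutSet X ⊆ F := by
      rw [← hb.eq_of_subset hne (hX' ▸ Set.inter_subset_left), hX']
      exact Set.inter_subset_right
    rw [← hi _ hS (Set.disjoint_compl_right_iff_subset.2 hs)]
    exact ZMod.total_congr fun e he => if_pos (hs he)

theorem eq_empty_or_univ (hD : D.IsMinimal) {Z : Set D.V} (hZ : D.cutSet Z = ∅) :
    Z = ∅ ∨ Z = Set.univ := by
  by_contra! hc
  obtain ⟨⟨x, hx⟩, hu⟩ := hc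
  obtain ⟨y, hy⟩ := (Set.ne_univ_iff_exists_notMem Z).1 hu
  have hmem : ∀ e, D.tail e ∈ Z ↔ D.head e ∈ Z := by
    intro e
    by_contra hc
    have := mem_cutSet.2 hc
    simp [hZ] at this
  refine hD.not_separation {e | D.tail e ∈ Z} ?_ ?_ fun X => ⟨X ∩ Z, ?_⟩
  · obtain ⟨e, rfl | rfl⟩ := hD.exists_edge x
    · exact ⟨e, hx⟩
    · exact ⟨e, (hmem e).2 hx⟩
  · obtain ⟨e, rfl | rfl⟩ := hD.exists_edge y
    · exact ⟨e, hy⟩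
    · exact ⟨e, fun h => hy ((hmem e).1 h)⟩
  · ext e
    have := hmem e
    simp only [mem_cutSet, Set.mem_inter_iff, Set.mem_ofPred_eq]
    tauto

theorem mem_cutSet_singleton (hD : D.IsMinimal) {x : D.V} {e : D.E} :
    e ∈ D.cutSet {x} ↔ D.tail e = x ∨ D.head e = x := by
  have := hD.tail_ne_head e
  rw [mem_cutSet, Set.mem_singleton_iff, Set.mem_singleton_iff]
  constructor
  · tauto
  · rintro (rfl | rfl)
    · simp [this.symm]
    · simp [this]

/-- A cut properly inside the star of `x` would make `x` a cut vertex. The edges meeting the side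
`Z` that avoids `x` would then form a separation of order one. -/
theorem isBond_singleton (hD : D.IsMinimal) (x : D.V) : D.IsBond (D.cutSet {x}) := by
  obtain ⟨e, he⟩ := hD.exists_edge x
  refine ⟨⟨⟨e, hD.mem_cutSet_singleton.2 he⟩, _, rfl⟩, ?_⟩
  have key : ∀ Z : Set D.V, x ∉ Z → (D.cutSet Z).Nonempty → ¬ D.cutSet Z ⊂ D.cutSet {x} := by
    rintro Z hx ⟨f, hf⟩ hs
    obtain ⟨g, hg, hgZ⟩ := Set.exists_of_ssubset hs
    have hmem : ∀ k, D.tail k ≠ x → D.head k ≠ x → (D.tail k ∈ Z ↔ D.head k ∈ Z) := by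
      intro k h1 h2
      by_contra hc
      have := hD.mem_cutSet_singleton.1 (hs.subset (mem_cutSet.2 hc))
      tauto
    have hxZ : ∀ y, y = x → y ∉ Z := fun y h => h ▸ hx
    refine hD.not_separation {k | D.tail k ∈ Z ∨ D.head k ∈ Z} ⟨f, ?_⟩ ⟨g, ?_⟩ fun X => ?_
    · rw [mem_cutSet] at hf
      change _ ∨ _
      tauto
    · rw [hD.mem_cutSet_singleton] at hg
      rw [mem_cutSet] at hgZ
      change ¬ (_ ∨ _)
      have h1 := hxZ (D.tail g)
      have h2 := hxZ (D.head g)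
      tauto
    · by_cases hX : x ∈ X
      · refine ⟨X ∪ Zᶜ, ?_⟩
        ext k
        have h0 := hmem k
        have h1 := hxZ (D.tail k)
        have h2 := hxZ (D.head k)
        have h3 : ∀ y, y = x → y ∈ X := fun y h => h ▸ hX
        have h4 := h3 (D.tail k)
        have h5 := h3 (D.head k)
        simp only [mem_cutSet, Set.mem_inter_iff, Set.mem_ofPred_eq, Set.mem_union,
          Set.mem_compl_iff]
        grind
      · refine ⟨X ∩ Z, ?_⟩
        ext k
        have h0 := hmem k
        have h1 := hxZ (D.tail k)
        have h2 := hxZ (D.head k)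
        have h3 : ∀ y, y = x → y ∉ X := fun y h => h ▸ hX
        have h4 := h3 (D.tail k)
        have h5 := h3 (D.head k)
        simp only [mem_cutSet, Set.mem_inter_iff, Set.mem_ofPred_eq]
        grind
  rintro _ ⟨hne, Z, rfl⟩
  by_cases hx : x ∈ Z
  · rw [← cutSet_compl Z] at hne ⊢
    exact key _ (fun h => h hx) hne
  · exact key _ hx hne

theorem isDirectedBond_singleton_of_source (hD : D.IsMinimal) {x : D.V}
    (h : ∀ e, D.head e ≠ x) : D.IsDirectedBond (D.cutSet {x}) :=
  isDirectedBond_iff.2 ⟨hD.isBond_singleton x, _, rfl, fun e he => absurd he (h e)⟩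

theorem isDirectedBond_singleton_of_sink (hD : D.IsMinimal) {x : D.V}
    (h : ∀ e, D.tail e ≠ x) : D.IsDirectedBond (D.cutSet {x}) :=
  isDirectedBond_of_isLower_compl (hD.isBond_singleton x) fun e _ => h e

/-! ### All edges in one directed cut: one-directions -/

section Bipartite

variable [Finite D.V] [Finite D.E]

/-- Contracting the edges inside `Z` preserves the bond of `Z` and the stars of the vertices
outside. That bond is odd and is the sum of these stars modulo two. -/
theorem odd_ncard_compl (hD : D.IsMinimal) (hs : ∀ x, D.IsDirectedBond (D.cutSet {x}))
    {Z : Set D.V} (hZ : D.IsDirectedBond (D.cutSet Z)) (h : Z.Nontrivial) : Odd Zᶜ.ncard := by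
  -- There is an edge inside `Z` to contract: otherwise the stars of `x` and `y` would both equal
  -- the cut of `Z`, and an edge in both would join `x` to `y`.
  obtain ⟨x, hx, y, hy, hxy⟩ := h
  have hne : {e | D.tail e ∈ Z ∧ D.head e ∈ Z}.Nonempty := by
    by_contra hc
    rw [Set.not_nonempty_iff_eq_empty] at hc
    have hmem : ∀ e, ¬ (D.tail e ∈ Z ∧ D.head e ∈ Z) := by
      intro e he
      have : e ∈ {e | D.tail e ∈ Z ∧ D.head e ∈ Z} := he
      simp [hc] at this
    have hsub : ∀ z ∈ Z, D.cutSet {z} = D.cutSet Z := by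
      intro z hz
      refine hZ.1.eq_of_subset (hD.isBond_singleton z).1.1 fun e he => ?_
      rw [hD.mem_cutSet_singleton] at he
      rw [mem_cutSet]
      have := hmem e
      rcases he with rfl | rfl <;> tauto
    obtain ⟨e, he⟩ := (hD.isBond_singleton x).1.1
    have he' : e ∈ D.cutSet {y} := by rwa [hsub y hy, ← hsub x hx]
    rw [hD.mem_cutSet_singleton] at he he'
    refine hmem e ?_
    rcases he with rfl | rfl <;> rcases he' with rfl | rfl
    · exact absurd rfl hxy
    · exact ⟨hx, hy⟩
    · exact ⟨hy, hx⟩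
    · exact absurd rfl hxy
  obtain ⟨j, hj⟩ := hD.exists_weighting _ hne
  rw [← ZMod.natCast_eq_one_iff_odd, ← total_cutSet_eq_ncard (j := j), cutSet_compl]
  · refine hj _ hZ (Set.disjoint_left.2 fun e he hc => ?_)
    rw [mem_cutSet] at he
    have : D.tail e ∈ Z ∧ D.head e ∈ Z := hc
    tauto
  · intro z hz
    refine hj _ (hs z) (Set.disjoint_left.2 fun e he hc => ?_)
    have hc' : D.tail e ∈ Z ∧ D.head e ∈ Z := hc
    rcases hD.mem_cutSet_singleton.1 he with rfl | rfl
    · exact hz hc'.1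
    · exact hz hc'.2

theorem odd_card (hD : D.IsMinimal) (hs : ∀ x, D.IsDirectedBond (D.cutSet {x})) :
    Odd (Nat.card D.V) := by
  by_contra hc
  rw [Nat.not_odd_iff_even] at hc
  -- With an even number of vertices and connectedness, the constant 1 is a boundary: the sum over
  -- each cut is the parity of either side. By `odd_ncard_compl` this is odd on every directed bond.
  obtain ⟨j, hj⟩ := exists_weighting_of_total (D := D) (fun _ => 1) (by
    intro Z hZ
    rcases hD.eq_empty_or_univ hZ with rfl | rfl
    · simp
    · rw [ZMod.total_one, Set.ncard_univ]
      exact ZMod.natCast_eq_zero_iff_even.2 hc)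
  refine hD.not_hasOddWeighting ⟨j, fun S hS => ?_⟩
  obtain ⟨hb, Z, rfl, -⟩ := isDirectedBond_iff.1 hS
  rw [hj, ZMod.total_one, ZMod.natCast_eq_one_iff_odd]
  by_cases hZ : Z.Nontrivial
  · rw [← Set.ncard_add_ncard_compl Z, Nat.even_add] at hc
    have h2 := hD.odd_ncard_compl hs hS hZ
    rw [← Nat.not_even_iff_odd] at h2 ⊢
    rwa [hc]
  · rcases Set.not_nontrivial_iff.1 hZ |>.eq_empty_or_singleton with rfl | ⟨z, rfl⟩
    · simpa using hb.1.1
    · simp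

/-- If both sides had at least two vertices, both would have odd size, while the number of vertices
is odd. -/
theorem exists_eq_cutSet_singleton (hD : D.IsMinimal)
    (hs : ∀ x, D.IsDirectedBond (D.cutSet {x})) {S : Set D.E} (hS : D.IsDirectedBond S) :
    ∃ x, S = D.cutSet {x} := by
  obtain ⟨hb, Z, rfl, -⟩ := isDirectedBond_iff.1 hS
  have hodd := hD.odd_card hs
  have key : ∀ Y : Set D.V, D.cutSet Y = D.cutSet Z → ¬ Y.Nontrivial →
      ∃ x, D.cutSet Z = D.cutSet {x} := by
    intro Y hY hn
    rcases Set.not_nontrivial_iff.1 hn |>.eq_empty_or_singleton with rfl | ⟨z, rfl⟩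
    · rw [← hY] at hb
      simpa using hb.1.1
    · exact ⟨z, hY.symm⟩
  by_cases h1 : Z.Nontrivial
  · by_cases h2 : Zᶜ.Nontrivial
    · have h3 := hD.odd_ncard_compl hs hS h1
      have h4 := hD.odd_ncard_compl hs (Z := Zᶜ) (by rwa [cutSet_compl]) h2
      rw [compl_compl] at h4
      rw [← Set.ncard_add_ncard_compl Z] at hodd
      exact absurd (h4.add_odd h3) (Nat.not_even_iff_odd.2 hodd)
    · exact key _ (cutSet_compl Z) h2
  · exact key _ rfl h1

theorem exists_edge_of_bipartite (hD : D.IsMinimal) {P : Set D.V}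
    (hP : ∀ e, D.tail e ∈ P ∧ D.head e ∉ P) (hs : ∀ x, D.IsDirectedBond (D.cutSet {x}))
    {a b : D.V} (ha : a ∈ P) (hb : b ∉ P) : ∃ e, D.tail e = a ∧ D.head e = b := by
  by_contra! hab
  -- `N` consists of the in-neighbours of `b`, and `C` adds their out-neighbours. `C` turns out to
  -- be a union of weak components containing `b` but not `a`.
  let N : Set D.V := {x | ∃ e, D.tail e = x ∧ D.head e = b}
  let C : Set D.V := {y | y ∈ N ∨ ∃ e, D.tail e ∈ N ∧ D.head e = y}
  have hNP : ∀ x ∈ N, x ∈ P := by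
    rintro _ ⟨e, rfl, -⟩
    exact (hP e).1
  have hX : D.IsLower (insert b N) := by
    rintro e (he | he)
    · exact Or.inr ⟨e, rfl, he⟩
    · exact absurd (hNP _ he) (hP e).2
  have hC : D.cutSet C = ∅ := by
    ext e
    rw [mem_cutSet]
    simp only [Set.mem_empty_iff_false, iff_false, not_not]
    constructor
    · rintro (h | ⟨f, -, h⟩)
      · exact Or.inr ⟨e, h, rfl⟩
      · exact absurd (h ▸ (hP e).1) (hP f).2
    · rintro (h | ⟨f, hf, hfe⟩)
      · exact absurd (hNP _ h) (hP e).2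
      refine Or.inl ?_
      by_cases hfb : D.head f = b
      · exact ⟨e, rfl, hfe ▸ hfb⟩
      have hfN : D.head f ∉ N := fun h => (hP f).2 (hNP _ h)
      have hfX : f ∈ D.cutSet (insert b N) := hX.mem_cutSet_iff.2 ⟨Or.inr hf, by
        rintro (h | h)
        · exact hfb h
        · exact hfN h⟩
      -- The bond through `f` inside this cut is the star of an end of `f`. It is not the tail's
      -- star, which contains an edge to `b` that is not in the cut; so it is the head's star, and
      -- all edges into that head come from `N`.
      obtain ⟨S, hS, hfS, hSX⟩ := hX.exists_isDirectedBond hfX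
      obtain ⟨z, rfl⟩ := hD.exists_eq_cutSet_singleton hs hS
      rcases hD.mem_cutSet_singleton.1 hfS with rfl | rfl
      · obtain ⟨g, hg, hgb⟩ := hf
        have := hX.mem_cutSet_iff.1 (hSX (hD.mem_cutSet_singleton.2 (Or.inl hg)))
        exact absurd (Or.inl hgb) this.2
      · have := hX.mem_cutSet_iff.1 (hSX (hD.mem_cutSet_singleton.2 (Or.inr hfe.symm)))
        exact this.1.resolve_left fun h => hb (h ▸ (hP e).1)
  have haC : a ∉ C := by
    rintro (⟨e, he, heb⟩ | ⟨e, -, he⟩)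
    · exact hab e he heb
    · exact (hP e).2 (he ▸ ha)
  rcases hD.eq_empty_or_univ hC with h | h
  · obtain ⟨e, he | he⟩ := hD.exists_edge b
    · exact hb (he ▸ (hP e).1)
    · have : D.tail e ∈ C := Or.inl ⟨e, rfl, he⟩
      simp [h] at this
  · exact haC (h ▸ Set.mem_univ a)

theorem isOddOneDirection (hD : D.IsMinimal) {P : Set D.V}
    (hP : ∀ e, D.tail e ∈ P ∧ D.head e ∉ P) : D.IsOddOneDirection := by
  classical
  have hs : ∀ x, D.IsDirectedBond (D.cutSet {x}) := by
    intro x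
    by_cases hx : x ∈ P
    · exact hD.isDirectedBond_singleton_of_source fun e h => (hP e).2 (h ▸ hx)
    · exact hD.isDirectedBond_singleton_of_sink fun e h => hx (h ▸ (hP e).1)
  have hodd := hD.odd_card hs
  have hE := fun (a b : D.V) (ha : a ∈ P) (hb : b ∉ P) => hD.exists_edge_of_bipartite hP hs ha hb
  -- If `Q` were a single vertex, `R` would have at least two since the total is odd. The star of a
  -- vertex of `R` would be contained in, hence equal to, the star of the vertex in `Q`, which has
  -- an edge to another vertex of `R`.
  have hone : ∀ Q R : Set D.V, Q ∪ R = Set.univ → Disjoint Q R →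
      (∀ a ∈ Q, ∀ b ∈ R, ∃ e, (D.tail e = a ∨ D.head e = a) ∧ (D.tail e = b ∨ D.head e = b)) →
      (∀ e, (D.tail e ∈ Q ∨ D.head e ∈ Q) ∧ (D.tail e ∈ R ∨ D.head e ∈ R)) → 2 ≤ Q.ncard := by
    intro Q R hQR hd hQ hQE
    by_contra hlt
    have hsum : Q.ncard + R.ncard = Nat.card D.V := by
      rw [← Set.ncard_union_eq hd, hQR, Set.ncard_univ]
    have hQne : 0 < Q.ncard := by
      obtain ⟨x⟩ : Nonempty D.V := (Nat.card_pos_iff.1 hodd.pos).1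
      obtain ⟨e, -⟩ := hD.exists_edge x
      rw [Set.ncard_pos]
      rcases (hQE e).1 with h | h
      · exact ⟨_, h⟩
      · exact ⟨_, h⟩
    have hQ1 : Q.ncard = 1 := by omega
    obtain ⟨a, rfl⟩ := Set.ncard_eq_one.1 hQ1
    have hR2 : 1 < R.ncard := by
      rw [← hsum, hQ1] at hodd
      have : R.ncard ≠ 0 := by
        intro h0
        obtain ⟨e, -⟩ := hD.exists_edge a
        rw [Set.ncard_eq_zero] at h0
        simpa [h0] using (hQE e).2
      have : R.ncard ≠ 1 := by
        intro h0
        rw [h0] at hodd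
        revert hodd
        decide
      omega
    obtain ⟨b, hb, b', hb', hbb⟩ := (Set.one_lt_ncard_iff_nontrivial).1 hR2
    have hab : a ≠ b := fun h => Set.disjoint_left.1 hd rfl (h ▸ hb)
    have hab' : a ≠ b' := fun h => Set.disjoint_left.1 hd rfl (h ▸ hb')
    have heq : D.cutSet {b} = D.cutSet {a} := by
      refine (hD.isBond_singleton a).eq_of_subset (hD.isBond_singleton b).1.1 fun e _ => ?_
      exact hD.mem_cutSet_singleton.2 (hQE e).1
    obtain ⟨e, he1, he2⟩ := hQ a rfl b' hb'
    have he3 : e ∈ D.cutSet {b} := heq ▸ hD.mem_cutSet_singleton.2 he1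
    rw [hD.mem_cutSet_singleton] at he3
    rcases he1 with rfl | rfl <;> rcases he2 with rfl | rfl <;> rcases he3 with rfl | rfl <;>
      first
      | exact hab rfl
      | exact hab' rfl
      | exact hbb rfl
  have hm : 2 ≤ P.ncard := hone P Pᶜ (Set.union_compl_self P) disjoint_compl_right
    (fun a ha b hb => (hE a b ha hb).imp fun e h => ⟨Or.inl h.1, Or.inr h.2⟩)
    fun e => ⟨Or.inl (hP e).1, Or.inr (hP e).2⟩
  have hn : 2 ≤ Pᶜ.ncard := hone Pᶜ P (Set.compl_union_self P) disjoint_compl_left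
    (fun a ha b hb => (hE b a hb ha).imp fun e h => ⟨Or.inr h.2, Or.inl h.1⟩)
    fun e => ⟨Or.inr (hP e).2, Or.inl (hP e).1⟩
  refine ⟨⟨P.ncard, Pᶜ.ncard, hm, hn, ⟨?_⟩⟩, hodd⟩
  let f : P ≃ Fin P.ncard := Finite.equivFinOfCardEq (Nat.card_coe_set_eq P)
  let g : (Pᶜ : Set D.V) ≃ Fin Pᶜ.ncard := Finite.equivFinOfCardEq (Nat.card_coe_set_eq Pᶜ)
  let v : D.V ≃ Fin P.ncard ⊕ Fin Pᶜ.ncard :=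
    (Equiv.Set.sumCompl P).symm.trans (Equiv.sumCongr f g)
  let h : D.E → Fin P.ncard × Fin Pᶜ.ncard := fun e =>
    (f ⟨D.tail e, (hP e).1⟩, g ⟨D.head e, (hP e).2⟩)
  have hbij : Function.Bijective h := by
    constructor
    · intro e e' hee
      rw [Prod.mk.injEq, f.injective.eq_iff, g.injective.eq_iff, Subtype.mk.injEq,
        Subtype.mk.injEq] at hee
      exact hD.eq_of_parallel hee.1 hee.2
    · rintro ⟨i, k⟩
      obtain ⟨e, h1, h2⟩ := hE (f.symm i) (g.symm k) (f.symm i).2 (g.symm k).2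
      refine ⟨e, Prod.ext ?_ ?_⟩
      · exact f.eq_symm_apply.1 (Subtype.ext h1)
      · exact g.eq_symm_apply.1 (Subtype.ext h2)
  refine ⟨v, Equiv.ofBijective h hbij, fun e => ?_, fun e => ?_⟩
  · have : v (D.tail e) = Sum.inl (f ⟨D.tail e, (hP e).1⟩) := by
      simp only [v, Equiv.trans_apply]
      rw [Equiv.Set.sumCompl_symm_apply_of_mem (hP e).1]
      rfl
    exact this.symm
  · have : v (D.head e) = Sum.inr (g ⟨D.head e, (hP e).2⟩) := by
      simp only [v, Equiv.trans_apply]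
      rw [Equiv.Set.sumCompl_symm_apply_of_notMem (hP e).2]
      rfl
    exact this.symm

end Bipartite

end IsMinimal

end MultiDigraph

/-! ### The parity of a directed cut and failures of modularity -/

namespace MultiDigraph

variable {D : MultiDigraph.{u, v}}

/-- `f X` is the parity of the number of directed bonds into which the directed cut `D[X, Xᶜ]`
decomposes, and this parity does not depend on the decomposition. -/
structure IsParity (D : MultiDigraph.{u, v}) (f : Set D.V → ZMod 2) : Prop where
  exists_weighting : ∀ X, D.IsLower X →
    ∃ j : D.E → ZMod 2, ∀ S, D.IsDirectedBond S → S ⊆ D.cutSet X → total j S = 1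
  total_eq : ∀ X, D.IsLower X → ∀ j : D.E → ZMod 2,
    (∀ S, D.IsDirectedBond S → S ⊆ D.cutSet X → total j S = 1) → total j (D.cutSet X) = f X

theorem exists_isParity [Finite D.E] (h : ∀ X, D.IsLower X →
    ∃ j : D.E → ZMod 2, ∀ S, D.IsDirectedBond S → S ⊆ D.cutSet X → total j S = 1) :
    ∃ f, D.IsParity f := by
  classical
  choose j hj using h
  -- Sets that are not lower receive the junk value 0; no property of `f` concerns them.
  refine ⟨fun X => if hX : D.IsLower X then total (j X hX) (D.cutSet X) else 0,
    fun X hX => ⟨j X hX, hj X hX⟩, fun X hX i hi => ?_⟩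
  rw [dif_pos hX]
  exact hX.total_congr hi (hj X hX)

namespace IsParity

variable {f : Set D.V → ZMod 2}

theorem eq_zero (hf : D.IsParity f) {X : Set D.V} (hX : D.cutSet X = ∅) : f X = 0 := by
  have hl := isLower_of_cutSet_eq_empty hX
  obtain ⟨j, hj⟩ := hf.exists_weighting X hl
  rw [← hf.total_eq X hl j hj, hX, ZMod.total_empty]

theorem eq_one (hf : D.IsParity f) {X : Set D.V} (hX : D.IsLower X)
    (hb : D.IsBond (D.cutSet X)) : f X = 1 := by
  obtain ⟨j, hj⟩ := hf.exists_weighting X hX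
  rw [← hf.total_eq X hX j hj]
  exact hj _ (isDirectedBond_iff.2 ⟨hb, X, rfl, hX⟩) subset_rfl

variable [Finite D.E]

theorem eq_add (hf : D.IsParity f) {X Y Z : Set D.V} (hX : D.IsLower X) (hY : D.IsLower Y)
    (hZ : D.IsLower Z) (h : D.cutSet X = D.cutSet Y ∪ D.cutSet Z)
    (hd : Disjoint (D.cutSet Y) (D.cutSet Z)) : f X = f Y + f Z := by
  obtain ⟨j, hj⟩ := hf.exists_weighting X hX
  rw [← hf.total_eq X hX j hj, h, ZMod.total_union _ hd,
    hf.total_eq Y hY j fun S hS hs => hj S hS (hs.trans (h ▸ Set.subset_union_left)),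
    hf.total_eq Z hZ j fun S hS hs => hj S hS (hs.trans (h ▸ Set.subset_union_right))]

/-- No edge joins the source `x` to `X`, so the cut of `insert x X` is the disjoint union of the cut
of `X` and the star of `x`. -/
theorem insert_eq_add (hf : D.IsParity f) {X : Set D.V} {x : D.V} (hx : x ∉ X)
    (hX : D.IsLower X) (hX' : D.IsLower (insert x X)) (hl : ∀ e, D.head e ≠ x)
    (h : ∀ e, D.tail e = x → D.head e ∉ X) : f (insert x X) = f X + f {x} := by
  have h1 : ∀ e, D.tail e = x → D.tail e ∉ X := fun e he => he ▸ hx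
  refine hf.eq_add hX' hX (fun e he => absurd he (hl e)) ?_ ?_
  · ext e
    have := hl e
    have := h e
    have := h1 e
    simp only [Set.mem_union, mem_cutSet, Set.mem_insert_iff, Set.mem_singleton_iff]
    grind
  · rw [Set.disjoint_left]
    intro e
    have := hl e
    have := h e
    have := h1 e
    simp only [mem_cutSet, Set.mem_singleton_iff]
    grind

/-- The dual for a sink `x` all of whose edges come from `X`: moving `x` into `X` removes its star
from the cut. The lower side of that star is `{x}ᶜ`. -/
theorem eq_insert_add (hf : D.IsParity f) {X : Set D.V} {x : D.V} (hx : x ∉ X)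
    (hX : D.IsLower X) (hX' : D.IsLower (insert x X)) (hl : ∀ e, D.tail e ≠ x)
    (h : ∀ e, D.head e = x → D.tail e ∈ X) : f X = f (insert x X) + f {x}ᶜ := by
  have h1 : ∀ e, D.head e = x → D.head e ∉ X := fun e he => he ▸ hx
  refine hf.eq_add hX hX' (fun e _ => hl e) ?_ ?_
  · ext e
    have := hl e
    have := h e
    have := h1 e
    simp only [Set.mem_union, mem_cutSet, Set.mem_insert_iff, Set.mem_singleton_iff,
      Set.mem_compl_iff]
    grind
  · rw [Set.disjoint_left]
    intro e
    have := hl e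
    have := h e
    have := h1 e
    simp only [mem_cutSet, Set.mem_singleton_iff, Set.mem_insert_iff, Set.mem_compl_iff]
    grind

end IsParity

/-- Two lower sets at which the function `f` violates modularity. -/
structure IsDefect (D : MultiDigraph.{u, v}) (f : Set D.V → ZMod 2) (X Y : Set D.V) : Prop where
  left : D.IsLower X
  right : D.IsLower Y
  ne : f X + f Y ≠ f (X ∪ Y) + f (X ∩ Y)

theorem IsDefect.symm {f : Set D.V → ZMod 2} {X Y : Set D.V} (h : D.IsDefect f X Y) :
    D.IsDefect f Y X :=
  ⟨h.right, h.left, by rw [add_comm, Set.union_comm, Set.inter_comm]; exact h.ne⟩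

namespace IsMinimal

/-- The vertices from which `x` can be reached. -/
def below (D : MultiDigraph.{u, v}) (x : D.V) : Set D.V :=
  {y | Relation.ReflTransGen (fun x y : D.V => ∃ f : D.E, D.tail f = x ∧ D.head f = y) y x}

theorem isLower_below (x : D.V) : D.IsLower (below D x) :=
  fun e he => Relation.ReflTransGen.head ⟨e, rfl, rfl⟩ he

variable [Finite D.V] [Finite D.E] {f : Set D.V → ZMod 2}

/-- Contracting the edges outside both cuts yields one weighting that computes `f` at `X`, `Y`,
their union and their intersection, whereas cut sums are modular. -/
theorem mem_cutSet_of_isDefect (hD : D.IsMinimal) (hf : D.IsParity f) {X Y : Set D.V}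
    (h : D.IsDefect f X Y) (e : D.E) : e ∈ D.cutSet X ∨ e ∈ D.cutSet Y := by
  by_contra he
  obtain ⟨j, hj⟩ := hD.exists_weighting (D.cutSet X ∪ D.cutSet Y)ᶜ ⟨e, he⟩
  have key : ∀ Z, D.IsLower Z → D.cutSet Z ⊆ D.cutSet X ∪ D.cutSet Y →
      total j (D.cutSet Z) = f Z := fun Z hZ hs =>
    hf.total_eq Z hZ j fun S hS hSZ =>
      hj S hS (Set.disjoint_compl_right_iff_subset.2 (hSZ.trans hs))
  refine h.ne ?_
  rw [← key X h.left Set.subset_union_left, ← key Y h.right Set.subset_union_right,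
    ← key (X ∪ Y) (h.left.union h.right), ← key (X ∩ Y) (h.left.inter h.right),
    total_cutSet_union_add_inter]
  · intro e
    simp only [mem_cutSet, Set.mem_inter_iff, Set.mem_union]
    tauto
  · intro e
    simp only [mem_cutSet, Set.mem_union]
    tauto

theorem exists_isDefect (hD : D.IsMinimal) (hf : D.IsParity f) : ∃ X Y, D.IsDefect f X Y := by
  by_contra! hc
  have hmod : ∀ X Y, D.IsLower X → D.IsLower Y → f X + f Y = f (X ∪ Y) + f (X ∩ Y) := by
    intro X Y hX hY
    by_contra h
    exact hc X Y ⟨hX, hY, h⟩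
  have hself : ∀ x, x ∈ below D x := fun x => Relation.ReflTransGen.refl
  have hbs : ∀ x, D.IsLower (below D x \ {x}) := by
    intro x e he
    refine ⟨isLower_below x e he.1, fun h => ?_⟩
    rw [Set.mem_singleton_iff] at h
    exact hD.acyclic e (h ▸ he.1)
  -- The increment of `f` on adding `x` to a lower set; modularity makes it independent of that set,
  -- so the smallest possible set is used.
  let w : D.V → ZMod 2 := fun x => f (below D x) + f (below D x \ {x})
  have hw : ∀ n : ℕ, ∀ X : Set D.V, X.ncard = n → D.IsLower X → total w X = f X := by
    intro n
    induction n with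
    | zero =>
      intro X hX _
      rw [Set.ncard_eq_zero] at hX
      rw [hX, ZMod.total_empty, hf.eq_zero cutSet_empty]
    | succ n ih =>
      intro X hX hl
      have hne : X.Nonempty := by
        rw [← Set.ncard_pos]
        omega
      -- By acyclicity `below` grows strictly along edges, so no edge leads from this `x` to a
      -- vertex of `X`, and removing it leaves a lower set.
      obtain ⟨x, hx, hmax⟩ := Set.exists_max_image X (fun x => (below D x).ncard)
        X.toFinite hne
      have hsub : below D x ⊆ X := by
        intro y hy
        induction hy using Relation.ReflTransGen.head_induction_on with
        | refl => exact hx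
        | head h _ ih =>
          obtain ⟨e, rfl, rfl⟩ := h
          exact hl e ih
      have hl' : D.IsLower (X \ {x}) := by
        rintro e ⟨he, -⟩
        refine ⟨hl e he, fun h => ?_⟩
        rw [Set.mem_singleton_iff] at h
        refine (hmax _ he).not_gt (Set.ncard_lt_ncard ?_ (Set.toFinite _))
        refine ⟨fun y hy => Relation.ReflTransGen.tail hy ⟨e, h, rfl⟩, fun hs => ?_⟩
        exact hD.acyclic e (h.symm ▸ hs (hself _))
      have h1 : X \ {x} ∪ below D x = X := by
        ext y
        constructor
        · rintro (h | h)
          · exact h.1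
          · exact hsub h
        · intro h
          by_cases hy : y = x
          · exact Or.inr (hy ▸ hself x)
          · exact Or.inl ⟨h, hy⟩
      have h2 : X \ {x} ∩ below D x = below D x \ {x} := by
        ext y
        exact ⟨fun h => ⟨h.2, h.1.2⟩, fun h => ⟨⟨hsub h.1, h.2⟩, h.1⟩⟩
      have h3 := hmod _ _ hl' (isLower_below x)
      rw [h1, h2] at h3
      have h4 : total w X = total w (X \ {x}) + w x := by
        rw [← ZMod.total_singleton w x, ← ZMod.total_union _ Set.disjoint_sdiff_left,
          Set.sdiff_union_of_subset (Set.singleton_subset_iff.2 hx)]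
      have h5 : (X \ {x}).ncard = n := by
        rw [Set.ncard_sdiff_singleton_of_mem hx, hX]
        rfl
      have h6 : f (below D x \ {x}) + f (below D x \ {x}) = 0 := CharTwo.add_self_eq_zero _
      rw [h4, ih _ h5 hl']
      simp only [w]
      linear_combination h3 + h6
  obtain ⟨j, hj⟩ := exists_weighting_of_total w fun Z hZ =>
    (hw _ Z rfl (isLower_of_cutSet_eq_empty hZ)).trans (hf.eq_zero hZ)
  refine hD.not_hasOddWeighting ⟨j, fun S hS => ?_⟩
  obtain ⟨hb, X, rfl, hX⟩ := isDirectedBond_iff.1 hS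
  rw [hj, hw _ X rfl hX, hf.eq_one hX hb]

/-- Choose a defect with the smallest symmetric difference. If `X \ Y` had a further vertex besides
`x`, the modular identities for `insert x (X ∩ Y)`, `Y` and for `X`, `insert x Y` would add up to
the one for `X`, `Y`; so one of these closer pairs would be a defect. -/
theorem exists_isDefect_insert (hD : D.IsMinimal) (hf : D.IsParity f) :
    ∃ N u v, u ∉ N ∧ v ∉ N ∧ u ≠ v ∧ D.IsDefect f (insert u N) (insert v N) := by
  have hleft : ∀ n : ℕ, (∀ X Y, (X \ Y).ncard + (Y \ X).ncard < n → ¬ D.IsDefect f X Y) →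
      ∀ X Y, (X \ Y).ncard + (Y \ X).ncard = n → D.IsDefect f X Y → ∃ u, X \ Y = {u} := by
    intro n ih X Y hn h
    have hne : (X \ Y).Nonempty := by
      by_contra hc
      rw [Set.not_nonempty_iff_eq_empty, Set.sdiff_eq_empty] at hc
      refine h.ne ?_
      rw [Set.union_eq_right.2 hc, Set.inter_eq_left.2 hc, add_comm]
    obtain ⟨x, hx⟩ := hne
    refine ⟨x, ?_⟩
    by_contra hX
    have hlt : 1 < (X \ Y).ncard := by
      have h0 : (X \ Y).ncard ≠ 0 := Set.ncard_ne_zero_of_mem hx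
      have h1 : (X \ Y).ncard ≠ 1 := by
        intro h1
        obtain ⟨y, hy⟩ := Set.ncard_eq_one.1 h1
        rw [hy] at hx
        exact hX (by rw [hy, hx])
      omega
    -- An edge into `x` starts in `X`, hence is not in the cut of `X`; so it is in the cut of `Y`
    -- and starts in `Y` as well.
    have hl : D.IsLower (insert x (X ∩ Y)) := by
      rintro e (he | he)
      · have h1 : D.tail e ∈ X := h.left e (he ▸ hx.1)
        have h2 := hD.mem_cutSet_of_isDefect hf h e
        rw [mem_cutSet, mem_cutSet, he] at h2
        have := hx.1
        have := hx.2
        refine Or.inr ⟨h1, ?_⟩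
        tauto
      · exact Or.inr (h.left.inter h.right e he)
    have hl' : D.IsLower (insert x Y) := by
      have : insert x Y = insert x (X ∩ Y) ∪ Y := by
        ext y
        simp only [Set.mem_insert_iff, Set.mem_union, Set.mem_inter_iff]
        tauto
      rw [this]
      exact hl.union h.right
    have s1 : insert x (X ∩ Y) \ Y = {x} := by
      ext y
      simp only [Set.mem_sdiff, Set.mem_insert_iff, Set.mem_inter_iff, Set.mem_singleton_iff]
      have := hx.2
      grind
    have s2 : Y \ insert x (X ∩ Y) = Y \ X := by
      ext y
      simp only [Set.mem_sdiff, Set.mem_insert_iff, Set.mem_inter_iff]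
      have := hx.2
      grind
    have s3 : X \ insert x Y = (X \ Y) \ {x} := by
      ext y
      simp only [Set.mem_sdiff, Set.mem_insert_iff, Set.mem_singleton_iff]
      tauto
    have s4 : insert x Y \ X = Y \ X := by
      ext y
      simp only [Set.mem_sdiff, Set.mem_insert_iff]
      have := hx.1
      grind
    have s5 : insert x (X ∩ Y) ∪ Y = insert x Y := by
      ext y
      simp only [Set.mem_insert_iff, Set.mem_union, Set.mem_inter_iff]
      tauto
    have s6 : insert x (X ∩ Y) ∩ Y = X ∩ Y := by
      ext y
      simp only [Set.mem_insert_iff, Set.mem_inter_iff]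
      have := hx.2
      grind
    have s7 : X ∪ insert x Y = X ∪ Y := by
      ext y
      simp only [Set.mem_insert_iff, Set.mem_union]
      have := hx.1
      grind
    have s8 : X ∩ insert x Y = insert x (X ∩ Y) := by
      ext y
      simp only [Set.mem_insert_iff, Set.mem_inter_iff]
      have := hx.1
      grind
    have h1 : f (insert x (X ∩ Y)) + f Y = f (insert x Y) + f (X ∩ Y) := by
      by_contra hc
      refine ih (insert x (X ∩ Y)) Y ?_ ⟨hl, h.right, by rwa [s5, s6]⟩
      rw [s1, s2, Set.ncard_singleton]
      omega
    have h2 : f X + f (insert x Y) = f (X ∪ Y) + f (insert x (X ∩ Y)) := by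
      by_contra hc
      refine ih X (insert x Y) ?_ ⟨h.left, hl', by rwa [s7, s8]⟩
      rw [s3, s4, Set.ncard_sdiff_singleton_of_mem hx]
      omega
    exact h.ne (by linear_combination h1 + h2)
  obtain ⟨X, Y, h, hmin⟩ : ∃ X Y, D.IsDefect f X Y ∧ ∀ X' Y',
      (X' \ Y').ncard + (Y' \ X').ncard < (X \ Y).ncard + (Y \ X).ncard →
        ¬ D.IsDefect f X' Y' := by
    obtain ⟨X, Y, h⟩ := hD.exists_isDefect hf
    induction hn : (X \ Y).ncard + (Y \ X).ncard using Nat.strong_induction_on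
      generalizing X Y with
    | _ n ih =>
      subst hn
      by_cases hc : ∃ X' Y', (X' \ Y').ncard + (Y' \ X').ncard <
          (X \ Y).ncard + (Y \ X).ncard ∧ D.IsDefect f X' Y'
      · obtain ⟨X', Y', hlt, h'⟩ := hc
        exact ih _ hlt X' Y' h' rfl
      · push Not at hc
        exact ⟨X, Y, h, hc⟩
  obtain ⟨x, hx⟩ := hleft _ hmin X Y rfl h
  obtain ⟨y, hy⟩ := hleft _ (fun X' Y' hlt => hmin X' Y' (by rwa [add_comm (Y \ X).ncard] at hlt))
    Y X rfl h.symm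
  have hx' : x ∈ X \ Y := hx ▸ rfl
  have hy' : y ∈ Y \ X := hy ▸ rfl
  have hX : insert x (X ∩ Y) = X := by
    rw [Set.insert_eq, ← hx, Set.sdiff_union_inter]
  have hY : insert y (X ∩ Y) = Y := by
    rw [Set.insert_eq, ← hy, Set.inter_comm, Set.sdiff_union_inter]
  exact ⟨X ∩ Y, x, y, fun h => hx'.2 h.2, fun h => hy'.2 h.1,
    fun h => hx'.2 (h ▸ hy'.1), by rwa [hX, hY]⟩

end IsMinimal

end MultiDigraph

/-! ### From a defect to an odd diamond -/

namespace MultiDigraph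

variable {D : MultiDigraph.{u, v}}

/-- A digraph with the adjacencies of a diamond and without parallel edges is a diamond. -/
theorem exists_iso_diamond [Finite D.V] {h₁ h₂ : D.V} (hne : h₁ ≠ h₂) (O : Set D.V)
    (hpar : ∀ e f, D.tail e = D.tail f → D.head e = D.head f → e = f)
    (hE : ∀ e, (D.tail e ∈ O ∧ D.tail e ∉ ({h₁, h₂} : Set D.V) ∧ D.head e ∈ ({h₁, h₂} : Set D.V)) ∨
      (D.head e ∉ O ∧ D.head e ∉ ({h₁, h₂} : Set D.V) ∧ D.tail e ∈ ({h₁, h₂} : Set D.V)))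
    (hO : ∀ x ∉ ({h₁, h₂} : Set D.V), x ∈ O → ∀ h ∈ ({h₁, h₂} : Set D.V),
      ∃ e, D.tail e = x ∧ D.head e = h)
    (hI : ∀ x ∉ ({h₁, h₂} : Set D.V), x ∉ O → ∀ h ∈ ({h₁, h₂} : Set D.V),
      ∃ e, D.tail e = h ∧ D.head e = x) :
    ∃ out : Fin ({h₁, h₂} : Set D.V)ᶜ.ncard → Bool, Nonempty (Iso D (diamond _ out)) := by
  classical
  let H : Set D.V := {h₁, h₂}
  let σ : (Hᶜ : Set D.V) ≃ Fin Hᶜ.ncard := Finite.equivFinOfCardEq (Nat.card_coe_set_eq Hᶜ)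
  let mid : Fin Hᶜ.ncard → D.V := fun i => (σ.symm i).1
  let hub : Fin 2 → D.V := ![h₁, h₂]
  have hmid : ∀ i, mid i ∉ H := fun i => (σ.symm i).2
  have hhub : ∀ c, hub c ∈ H := by
    intro c
    fin_cases c
    · exact Or.inl rfl
    · exact Or.inr rfl
  have hmid' : ∀ x ∉ H, ∃ i, mid i = x := fun x hx => ⟨σ ⟨x, hx⟩, by simp [mid]⟩
  have hhub' : ∀ x ∈ H, ∃ c, hub c = x := by
    rintro x (rfl | rfl)
    · exact ⟨0, rfl⟩
    · exact ⟨1, rfl⟩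
  have hmidi : Function.Injective mid := Subtype.val_injective.comp σ.symm.injective
  have hhubi : Function.Injective hub := by
    intro c d hcd
    fin_cases c <;> fin_cases d
    · rfl
    · exact absurd hcd hne
    · exact absurd hcd.symm hne
    · rfl
  have hv : Function.Bijective (Sum.elim mid hub) := by
    refine ⟨hmidi.sumElim hhubi fun i c h => hmid i (h ▸ hhub c), fun x => ?_⟩
    by_cases hx : x ∈ H
    · obtain ⟨c, hc⟩ := hhub' x hx
      exact ⟨Sum.inr c, hc⟩
    · obtain ⟨i, hi⟩ := hmid' x hx
      exact ⟨Sum.inl i, hi⟩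
  let out : Fin Hᶜ.ncard → Bool := fun i => decide (mid i ∈ O)
  have hex : ∀ p : Fin Hᶜ.ncard × Fin 2, ∃ e,
      D.tail e = Sum.elim mid hub (if out p.1 then Sum.inl p.1 else Sum.inr p.2) ∧
      D.head e = Sum.elim mid hub (if out p.1 then Sum.inr p.2 else Sum.inl p.1) := by
    rintro ⟨i, c⟩
    by_cases h : mid i ∈ O
    · simpa [out, h] using hO (mid i) (hmid i) h (hub c) (hhub c)
    · simpa [out, h] using hI (mid i) (hmid i) h (hub c) (hhub c)
  choose g hgt hgh using hex
  have hg : Function.Bijective g := by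
    constructor
    · rintro ⟨i, c⟩ ⟨k, d⟩ hik
      have ht := hgt (i, c)
      have hh := hgh (i, c)
      rw [hik, hgt, hv.1.eq_iff] at ht
      rw [hik, hgh, hv.1.eq_iff] at hh
      cases h : out i <;> cases h' : out k <;>
        simp only [h, h', if_true, Bool.false_eq_true, if_false, Sum.inl.injEq, Sum.inr.injEq,
          reduceCtorEq] at ht hh
      · rw [ht, hh]
      · rw [ht, hh]
    · intro e
      rcases hE e with ⟨h1, h2, h3⟩ | ⟨h1, h2, h3⟩
      · obtain ⟨i, hi⟩ := hmid' _ h2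
        obtain ⟨c, hc⟩ := hhub' _ h3
        have ho : out i := by simpa [out, hi] using h1
        refine ⟨(i, c), hpar _ _ ?_ ?_⟩
        · rw [hgt, ← hi]
          simp [ho]
        · rw [hgh, ← hc]
          simp [ho]
      · obtain ⟨i, hi⟩ := hmid' _ h2
        obtain ⟨c, hc⟩ := hhub' _ h3
        have ho : out i = false := by simpa [out, hi] using h1
        refine ⟨(i, c), hpar _ _ ?_ ?_⟩
        · rw [hgt, ← hc]
          simp [ho]
        · rw [hgh, ← hi]
          simp [ho]
  let φ : Iso (diamond _ out) D :=
    { vert := Equiv.ofBijective _ hv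
      edge := Equiv.ofBijective g hg
      tail_eq := hgt
      head_eq := hgh }
  exact ⟨out, ⟨φ.symm⟩⟩

namespace IsMinimal

variable [Finite D.V] [Finite D.E] {f : Set D.V → ZMod 2}

/-- The vertices of `N` are sources. If `n` has no edge to `u`, removing `n` from both sets in turn
preserves the defect, because each affected value of `f` changes by `f {n}`. Every edge must be in
one of the two cuts throughout, which finally leaves `n` without edges. -/
theorem exists_edge_of_mem (hD : D.IsMinimal) (hf : D.IsParity f) {N : Set D.V} {u v n : D.V}
    (hu : u ∉ N) (hv : v ∉ N) (huv : u ≠ v) (h : D.IsDefect f (insert u N) (insert v N))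
    (hn : n ∈ N) : ∃ e, D.tail e = n ∧ D.head e = u := by
  by_contra! hc
  have hE : ∀ e, D.head e ∉ N := by
    intro e he
    have h1 := h.left e (Or.inr he)
    have h2 := h.right e (Or.inr he)
    have h3 := hD.mem_cutSet_of_isDefect hf h e
    simp only [mem_cutSet, Set.mem_insert_iff] at h1 h2 h3
    tauto
  have hnu : n ≠ u := fun h => hu (h ▸ hn)
  have hnv : n ≠ v := fun h => hv (h ▸ hn)
  let Q := N \ {n}
  have hnQ : n ∉ Q := fun h => h.2 rfl
  have hQN : insert n Q = N := Set.insert_sdiff_self_of_mem hn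
  have hQ : D.IsLower Q := fun e he => absurd he.1 (hE e)
  have hN : D.IsLower N := fun e he => absurd he (hE e)
  have hne : ∀ e, D.head e ≠ n := fun e he => hE e (he ▸ hn)
  have hlow : ∀ x, D.IsLower (insert x N) → (∀ e, D.tail e = n → D.head e ≠ x) →
      D.IsLower (insert x Q) := by
    rintro x hx hnx e (he | he)
    · rcases hx e (Or.inl he) with h1 | h1
      · exact Or.inl h1
      · exact Or.inr ⟨h1, fun h => hnx e h he⟩
    · exact absurd he.1 (hE e)
  have huQ := hlow u h.left hc
  have f1 : ∀ Y : Set D.V, n ∉ Y → D.IsLower Y → D.IsLower (insert n Y) →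
      (∀ e, D.tail e = n → D.head e ∉ Y) → f (insert n Y) = f Y + f {n} :=
    fun Y h1 h2 h3 h4 => hf.insert_eq_add h1 h2 h3 hne h4
  have a1 := f1 Q hnQ hQ (by rwa [hQN]) fun e _ he => hE e he.1
  have a2 := f1 (insert u Q) (by simp [hnu, hnQ]) huQ (by rw [Set.insert_comm, hQN]; exact h.left)
    (by
      rintro e he (h | h)
      · exact hc e he h
      · exact hE e h.1)
  rw [hQN] at a1
  rw [Set.insert_comm, hQN] at a2
  have s1 : insert u N ∪ insert v N = insert u (insert v N) := by
    ext x; simp only [Set.mem_union, Set.mem_insert_iff]; tauto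
  have s2 : insert u N ∩ insert v N = N := by
    ext x; simp only [Set.mem_inter_iff, Set.mem_insert_iff]; grind
  have s3 : insert u Q ∪ insert v N = insert u (insert v N) := by
    rw [← hQN]
    ext x; simp only [Set.mem_union, Set.mem_insert_iff]; grind
  have s4 : insert u Q ∩ insert v N = Q := by
    rw [← hQN]
    ext x; simp only [Set.mem_inter_iff, Set.mem_insert_iff]; grind
  have d1 : D.IsDefect f (insert u Q) (insert v N) := by
    refine ⟨huQ, h.right, fun hh => h.ne ?_⟩
    rw [s3, s4] at hh
    rw [s1, s2]
    linear_combination hh + a2 - a1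
  -- An edge from `n` to `v` would have both ends outside `insert u Q` and both inside `insert v N`,
  -- hence be in neither cut of the new defect.
  have hcv : ∀ e, D.tail e = n → D.head e ≠ v := by
    intro e he hev
    have := hD.mem_cutSet_of_isDefect hf d1 e
    rw [mem_cutSet, mem_cutSet, he, hev] at this
    have h1 : v ∉ Q := fun h => hv h.1
    simp only [Set.mem_insert_iff] at this
    grind
  have hvQ := hlow v h.right hcv
  have a3 := f1 (insert v Q) (by simp [hnv, hnQ]) hvQ (by rw [Set.insert_comm, hQN]; exact h.right)
    (by
      rintro e he (h | h)
      · exact hcv e he h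
      · exact hE e h.1)
  have s5 : insert u Q ∪ insert v Q = insert u (insert v Q) := by
    ext x; simp only [Set.mem_union, Set.mem_insert_iff]; tauto
  have s6 : insert u Q ∩ insert v Q = Q := by
    have : v ∉ Q := fun h => hv h.1
    ext x; simp only [Set.mem_inter_iff, Set.mem_insert_iff]; grind
  have s7 : insert n (insert u (insert v Q)) = insert u (insert v N) := by
    rw [← hQN]
    ext x; simp only [Set.mem_insert_iff]; tauto
  have a4 := f1 (insert u (insert v Q)) (by simp [hnu, hnv, hnQ]) (s5 ▸ huQ.union hvQ)
    (by rw [s7, ← s1]; exact h.left.union h.right)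
    (by
      rintro e he (h | h | h)
      · exact hc e he h
      · exact hcv e he h
      · exact hE e h.1)
  rw [s7] at a4
  rw [Set.insert_comm, hQN] at a3
  have d2 : D.IsDefect f (insert u Q) (insert v Q) := by
    refine ⟨huQ, hvQ, fun hh => h.ne ?_⟩
    rw [s5, s6] at hh
    rw [s1, s2]
    linear_combination hh + a2 + a3 - a1 - a4
  obtain ⟨e, he | he⟩ := hD.exists_edge n
  · have h1 := hD.mem_cutSet_of_isDefect hf d2 e
    have h2 := hE e
    have h3 := hc e he
    have h4 := hcv e he
    have h5 : D.head e ∉ Q := fun h => hE e h.1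
    rw [mem_cutSet, mem_cutSet, he] at h1
    simp only [Set.mem_insert_iff] at h1
    tauto
  · exact hne e he

/-- The dual argument: `m` is a sink, and adding it to the two sets in turn preserves the defect
until no edge at `m` is possible. -/
theorem exists_edge_of_notMem (hD : D.IsMinimal) (hf : D.IsParity f) {N : Set D.V}
    {u v m : D.V} (hv : v ∉ N) (huv : u ≠ v)
    (h : D.IsDefect f (insert u N) (insert v N))
    (hm : m ∉ N) (hmu : m ≠ u) (hmv : m ≠ v) : ∃ e, D.tail e = u ∧ D.head e = m := by
  by_contra! hc
  have s1 : insert u N ∪ insert v N = insert u (insert v N) := by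
    ext x; simp only [Set.mem_union, Set.mem_insert_iff]; tauto
  have s2 : insert u N ∩ insert v N = N := by
    ext x; simp only [Set.mem_inter_iff, Set.mem_insert_iff]; grind
  have hW : D.IsLower (insert u (insert v N)) := s1 ▸ h.left.union h.right
  have hN : D.IsLower N := by
    have := h.left.inter h.right
    rwa [s2] at this
  have hE : ∀ e, D.tail e ∈ insert u (insert v N) := by
    intro e
    by_contra hh
    have h1 := hW e
    have h3 := hD.mem_cutSet_of_isDefect hf h e
    simp only [mem_cutSet, Set.mem_insert_iff] at h1 h3 hh
    tauto
  have hmW : m ∉ insert u (insert v N) := by simp [hm, hmu, hmv]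
  have hne : ∀ e, D.tail e ≠ m := fun e he => hmW (he ▸ hE e)
  have f1 : ∀ Y : Set D.V, m ∉ Y → D.IsLower Y → D.IsLower (insert m Y) →
      (∀ e, D.head e = m → D.tail e ∈ Y) → f Y = f (insert m Y) + f {m}ᶜ :=
    fun Y h1 h2 h3 h4 => hf.eq_insert_add h1 h2 h3 hne h4
  have hlow : ∀ Y, D.IsLower Y → (∀ e, D.head e = m → D.tail e ∈ Y) →
      D.IsLower (insert m Y) := by
    rintro Y hY hmY e (he | he)
    · exact Or.inr (hmY e he)
    · exact Or.inr (hY e he)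
  have b1 : ∀ e, D.head e = m → D.tail e ∈ insert u (insert v N) := fun e _ => hE e
  have b2 : ∀ e, D.head e = m → D.tail e ∈ insert v N := fun e he =>
    (hE e).resolve_left fun h => hc e h he
  have a1 := f1 _ hmW hW (hlow _ hW b1) b1
  have a2 := f1 (insert v N) (by simp [hm, hmv]) h.right (hlow _ h.right b2) b2
  have s3 : insert u N ∪ insert m (insert v N) = insert m (insert u (insert v N)) := by
    ext x; simp only [Set.mem_union, Set.mem_insert_iff]; tauto
  have s4 : insert u N ∩ insert m (insert v N) = N := by
    ext x; simp only [Set.mem_inter_iff, Set.mem_insert_iff]; grind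
  have d1 : D.IsDefect f (insert u N) (insert m (insert v N)) := by
    refine ⟨h.left, hlow _ h.right b2, fun hh => h.ne ?_⟩
    rw [s3, s4] at hh
    rw [s1, s2]
    linear_combination hh + a2 - a1
  have b3 : ∀ e, D.head e = m → D.tail e ∈ N := by
    intro e he
    refine (b2 e he).resolve_left fun hev => ?_
    have := hD.mem_cutSet_of_isDefect hf d1 e
    rw [mem_cutSet, mem_cutSet, he, hev] at this
    simp only [Set.mem_insert_iff] at this
    grind
  have b4 : ∀ e, D.head e = m → D.tail e ∈ insert u N := fun e he => Or.inr (b3 e he)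
  have a3 := f1 (insert u N) (by simp [hm, hmu]) h.left (hlow _ h.left b4) b4
  have a4 := f1 N hm hN (hlow _ hN b3) b3
  have s5 : insert m (insert u N) ∪ insert m (insert v N) = insert m (insert u (insert v N)) := by
    ext x; simp only [Set.mem_union, Set.mem_insert_iff]; tauto
  have s6 : insert m (insert u N) ∩ insert m (insert v N) = insert m N := by
    ext x; simp only [Set.mem_inter_iff, Set.mem_insert_iff]; grind
  have d2 : D.IsDefect f (insert m (insert u N)) (insert m (insert v N)) := by
    refine ⟨hlow _ h.left b4, hlow _ h.right b2, fun hh => h.ne ?_⟩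
    rw [s5, s6] at hh
    rw [s1, s2]
    linear_combination hh + a2 + a3 - a1 - a4
  obtain ⟨e, he | he⟩ := hD.exists_edge m
  · exact hne e he
  · have h1 := hD.mem_cutSet_of_isDefect hf d2 e
    have h2 := b3 e he
    rw [mem_cutSet, mem_cutSet, he] at h1
    simp only [Set.mem_insert_iff] at h1
    tauto

theorem isOddDiamond (hD : D.IsMinimal) (hf : D.IsParity f) : D.IsOddDiamond := by
  obtain ⟨N, u, v, hu, hv, huv, h⟩ := hD.exists_isDefect_insert hf
  have s1 : insert u N ∪ insert v N = insert u (insert v N) := by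
    ext x; simp only [Set.mem_union, Set.mem_insert_iff]; tauto
  have s2 : insert u N ∩ insert v N = N := by
    ext x; simp only [Set.mem_inter_iff, Set.mem_insert_iff]; grind
  have hW : D.IsLower (insert u (insert v N)) := s1 ▸ h.left.union h.right
  have hN : D.IsLower N := by
    have := h.left.inter h.right
    rwa [s2] at this
  have hNu : ∀ n ∈ N, ∃ e, D.tail e = n ∧ D.head e = u := fun n hn =>
    hD.exists_edge_of_mem hf hu hv huv h hn
  have hNv : ∀ n ∈ N, ∃ e, D.tail e = n ∧ D.head e = v := fun n hn =>
    hD.exists_edge_of_mem hf hv hu huv.symm h.symm hn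
  have huM : ∀ m, m ∉ N → m ≠ u → m ≠ v → ∃ e, D.tail e = u ∧ D.head e = m :=
    fun m hm hmu hmv => hD.exists_edge_of_notMem hf hv huv h hm hmu hmv
  have hvM : ∀ m, m ∉ N → m ≠ u → m ≠ v → ∃ e, D.tail e = v ∧ D.head e = m :=
    fun m hm hmu hmv => hD.exists_edge_of_notMem hf hu huv.symm h.symm hm hmv hmu
  -- Such an edge would be bypassed by a path of length two through `u`, hence deletable.
  have hNM : ∀ e, D.tail e ∈ N → D.head e ∉ N → D.head e ≠ u → D.head e ≠ v → False := by
    intro e h1 h2 h3 h4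
    obtain ⟨a, ha, ha'⟩ := hNu _ h1
    obtain ⟨b, hb, hb'⟩ := huM _ h2 h3 h4
    refine hD.not_isDeletable e ⟨hD.tail_ne_head e,
      Relation.ReflTransGen.head ⟨a, ?_, ha, ha'⟩
        (Relation.ReflTransGen.single ⟨b, ?_, hb, hb'⟩)⟩
    · rintro rfl
      exact h3 ha'
    · rintro rfl
      exact hu (hb ▸ h1)
  have hE : ∀ e, (D.tail e ∈ N ∧ (D.head e = u ∨ D.head e = v)) ∨
      ((D.tail e = u ∨ D.tail e = v) ∧ D.head e ∉ N ∧ D.head e ≠ u ∧ D.head e ≠ v) := by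
    intro e
    have h1 := hD.mem_cutSet_of_isDefect hf h e
    have h2 := h.left e
    have h3 := h.right e
    have h4 := hNM e
    have h5 := hD.tail_ne_head e
    simp only [mem_cutSet, Set.mem_insert_iff] at h1 h2 h3
    grind
  have hNout : ∀ e, D.head e ∉ N := by
    intro e
    rcases hE e with ⟨-, h | h⟩ | h
    · rwa [h]
    · rwa [h]
    · exact h.2.1
  have hMin : ∀ e x, x ∉ N → x ≠ u → x ≠ v → D.tail e ≠ x := by
    rintro e x h1 h2 h3 rfl
    rcases hE e with h | ⟨h | h, -⟩
    · exact h1 h.1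
    · exact h2 h
    · exact h3 h
  have hbond : ∀ u v : D.V, u ≠ v → u ∉ N → v ∉ N → D.IsLower (insert u N) →
      (∀ n ∈ N, ∃ e, D.tail e = n ∧ D.head e = u) →
      (∀ n ∈ N, ∃ e, D.tail e = n ∧ D.head e = v) →
      (∀ m, m ∉ N → m ≠ u → m ≠ v → ∃ e, D.tail e = v ∧ D.head e = m) →
      (∀ e, (D.tail e ∈ N ∧ (D.head e = u ∨ D.head e = v)) ∨
        ((D.tail e = u ∨ D.tail e = v) ∧ D.head e ∉ N ∧ D.head e ≠ u ∧ D.head e ≠ v)) →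
      f (insert u N) = 1 := by
    intro u v huv hu hv hl hNu hNv hvM hE
    refine hf.eq_one hl (isBond_cutSet u v ?_ ?_ ?_)
    · obtain ⟨e, he | he⟩ := hD.exists_edge u
      · refine ⟨e, hl.mem_cutSet_iff.2 ⟨Or.inl he, ?_⟩⟩
        rcases hE e with h | h
        · exact absurd (he ▸ h.1) hu
        · simp [h.2.1, h.2.2.1]
      · rcases hE e with h | h
        · obtain ⟨g, hg, hg'⟩ := hNv _ h.1
          exact ⟨g, hl.mem_cutSet_iff.2 ⟨Or.inr (hg ▸ h.1), by simp [hg', huv.symm, hv]⟩⟩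
        · exact absurd he h.2.2.1
    · rintro Z hZ z (hz | hz)
      · rw [hz]
      · obtain ⟨e, rfl, rfl⟩ := hNu z hz
        exact mem_iff_of_cutSet_subset hZ (by simp [hz])
    · intro Z hZ z hz
      by_cases hzv : z = v
      · rw [hzv]
      · obtain ⟨e, rfl, rfl⟩ := hvM z (fun h => hz (Or.inr h)) (fun h => hz (Or.inl h)) hzv
        exact (mem_iff_of_cutSet_subset hZ (by simp [hz, huv.symm, hv])).symm
  have f1 : f (insert u N) = 1 := hbond u v huv hu hv h.left hNu hNv hvM hE
  have f2 : f (insert v N) = 1 := by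
    refine hbond v u huv.symm hv hu h.right hNv hNu (fun m h1 h2 h3 => huM m h1 h3 h2) fun e => ?_
    have := hE e
    tauto
  have f3 : f N = N.ncard := by
    obtain ⟨j, hj⟩ := hf.exists_weighting N hN
    rw [← hf.total_eq N hN j hj]
    refine total_cutSet_eq_ncard fun x hx => hj _
      (hD.isDirectedBond_singleton_of_source fun e he => hNout e (he ▸ hx)) fun e he => ?_
    rcases hD.mem_cutSet_singleton.1 he with rfl | rfl
    · exact hN.mem_cutSet_iff.2 ⟨hx, hNout e⟩
    · exact absurd hx (hNout e)
  have f4 : f (insert u (insert v N)) = (insert u (insert v N))ᶜ.ncard := by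
    obtain ⟨j, hj⟩ := hf.exists_weighting _ hW
    rw [← hf.total_eq _ hW j hj, ← cutSet_compl]
    refine total_cutSet_eq_ncard fun x hx => ?_
    have hx' : x ∉ N ∧ x ≠ u ∧ x ≠ v := by
      simp only [Set.mem_compl_iff, Set.mem_insert_iff] at hx
      tauto
    refine hj _ (hD.isDirectedBond_singleton_of_sink fun e =>
      hMin e x hx'.1 hx'.2.1 hx'.2.2) fun e he => ?_
    rcases hD.mem_cutSet_singleton.1 he with rfl | rfl
    · exact absurd rfl (hMin e _ hx'.1 hx'.2.1 hx'.2.2)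
    · refine hW.mem_cutSet_iff.2 ⟨?_, hx⟩
      rcases hE e with h | h
      · exact Or.inr (Or.inr h.1)
      · exact h.1.imp id Or.inl
  -- The defect says that `1 + 1` differs from the sum of the numbers of sources and sinks modulo
  -- two.
  have hodd : Odd ({u, v} : Set D.V)ᶜ.ncard := by
    have hun : N ∪ (insert u (insert v N))ᶜ = ({u, v} : Set D.V)ᶜ := by
      ext x
      simp only [Set.mem_union, Set.mem_compl_iff, Set.mem_insert_iff, Set.mem_singleton_iff]
      grind
    have hd : Disjoint N (insert u (insert v N))ᶜ := by
      rw [Set.disjoint_left]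
      exact fun x hx hc => hc (Or.inr (Or.inr hx))
    have hne := h.ne
    rw [f1, f2, s1, s2, f3, f4] at hne
    rw [← hun, Set.ncard_union_eq hd, ← ZMod.natCast_eq_one_iff_odd, Nat.cast_add]
    revert hne
    generalize (N.ncard : ZMod 2) = a
    generalize ((insert u (insert v N))ᶜ.ncard : ZMod 2) = b
    revert a b
    decide
  have hedge : ∀ e, ∃ y ∈ ({u, v} : Set D.V)ᶜ, D.tail e = y ∨ D.head e = y := by
    intro e
    rcases hE e with h | h
    · refine ⟨_, ?_, Or.inl rfl⟩
      rintro (h' | h')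
      · exact hu (h' ▸ h.1)
      · exact hv (h' ▸ h.1)
    · refine ⟨_, ?_, Or.inr rfl⟩
      rintro (h' | h')
      · exact h.2.2.1 h'
      · exact h.2.2.2 h'
  have hthree : 3 ≤ ({u, v} : Set D.V)ᶜ.ncard := by
    -- With a single middle vertex `x`, the star of `u` would be contained in the star of `x` and
    -- hence equal to it, although `x` is also adjacent to `v`.
    have hne1 : ({u, v} : Set D.V)ᶜ.ncard ≠ 1 := by
      intro h1
      obtain ⟨x, hx⟩ := Set.ncard_eq_one.1 h1
      have hxm : x ∈ ({u, v} : Set D.V)ᶜ := hx ▸ rfl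
      have hxu : x ≠ u := fun h => hxm (Or.inl h)
      have hxv : x ≠ v := fun h => hxm (Or.inr h)
      have heq : D.cutSet {u} = D.cutSet {x} := by
        refine (hD.isBond_singleton x).eq_of_subset (hD.isBond_singleton u).1.1 fun e _ => ?_
        obtain ⟨y, hy, hye⟩ := hedge e
        rw [hx] at hy
        exact hD.mem_cutSet_singleton.2 (hy ▸ hye)
      have hnot : ∀ e, (D.tail e = x ∧ D.head e = v) ∨ (D.tail e = v ∧ D.head e = x) → False := by
        intro e he
        have h2 : e ∈ D.cutSet {x} := hD.mem_cutSet_singleton.2 (by tauto)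
        rw [← heq, hD.mem_cutSet_singleton] at h2
        rcases he with ⟨rfl, rfl⟩ | ⟨rfl, rfl⟩ <;> rcases h2 with h2 | h2
        · exact hxu h2
        · exact huv h2.symm
        · exact huv h2.symm
        · exact hxu h2
      by_cases hxN : x ∈ N
      · obtain ⟨e, he⟩ := hNv x hxN
        exact hnot e (Or.inl he)
      · obtain ⟨e, he⟩ := hvM x hxN hxu hxv
        exact hnot e (Or.inr he)
    obtain ⟨k, hk⟩ := hodd
    omega
  have hH : ∀ x, x ∉ ({u, v} : Set D.V) ↔ x ≠ u ∧ x ≠ v := by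
    intro x
    simp only [Set.mem_insert_iff, Set.mem_singleton_iff]
    tauto
  obtain ⟨out, hiso⟩ := exists_iso_diamond huv N (fun e e' => hD.eq_of_parallel) (by
    intro e
    rw [hH, hH]
    rcases hE e with h | h
    · exact Or.inl ⟨h.1, ⟨fun h' => hu (h' ▸ h.1), fun h' => hv (h' ▸ h.1)⟩, h.2⟩
    · exact Or.inr ⟨h.2.1, h.2.2, h.1⟩) (by
    rintro x - hx y (rfl | rfl)
    · exact hNu x hx
    · exact hNv x hx) (by
    rintro x hx hxN y (rfl | rfl)
    · exact huM x hxN ((hH x).1 hx).1 ((hH x).1 hx).2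
    · exact hvM x hxN ((hH x).1 hx).1 ((hH x).1 hx).2)
  refine ⟨⟨_, out, hthree, hiso⟩, ?_⟩
  rw [← Set.ncard_add_ncard_compl ({u, v} : Set D.V), Set.ncard_pair huv, Nat.odd_add']
  exact ⟨fun _ => by decide, fun _ => hodd⟩

theorem isOddDiamond_or_isOddOneDirection (hD : D.IsMinimal) :
    D.IsOddDiamond ∨ D.IsOddOneDirection := by
  by_cases h : ∀ X, D.IsLower X →
      ∃ j : D.E → ZMod 2, ∀ S, D.IsDirectedBond S → S ⊆ D.cutSet X → total j S = 1
  · obtain ⟨f, hf⟩ := exists_isParity h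
    exact Or.inl (hD.isOddDiamond hf)
  · push Not at h
    obtain ⟨P, hP, h⟩ := h
    -- If some edge were outside the cut of `P`, contracting all such edges would give a weighting
    -- odd on all directed bonds inside this cut.
    refine Or.inr (hD.isOddOneDirection (P := P) fun e => hP.mem_cutSet_iff.1 ?_)
    by_contra he
    obtain ⟨j, hj⟩ := hD.exists_weighting (D.cutSet P)ᶜ ⟨e, he⟩
    obtain ⟨S, hS, hs, hne⟩ := h j
    exact hne (hj S hS (Set.disjoint_compl_right_iff_subset.2 hs))

end IsMinimal

/-! ### Reduction to a minimal digraph and the main theorem -/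

theorem exists_cutMinor_of_not_hasOddWeighting (n : ℕ) :
    ∀ (D : MultiDigraph.{u, v}) [Finite D.V] [Finite D.E], Nat.card D.V + Nat.card D.E = n →
      ¬ D.HasOddWeighting →
      ∃ D' : MultiDigraph.{u, v}, D'.IsCutMinor D ∧ (D'.IsOddDiamond ∨ D'.IsOddOneDirection) := by
  induction n using Nat.strong_induction_on with
  | _ n ih =>
    intro D _ _ hn hD
    by_contra! hno
    have step : ∀ D' : MultiDigraph.{u, v}, CutMinorStep D D' →
        Nat.card D'.V + Nat.card D'.E < n → D'.HasOddWeighting := by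
      intro D' hs hlt
      by_contra hc
      obtain ⟨h1, h2⟩ := hs.finite ⟨inferInstance, inferInstance⟩
      obtain ⟨D'', hm, hD''⟩ := ih _ hlt D' rfl hc
      rcases hD'' with h | h
      · exact (hno D'' (Relation.ReflTransGen.head hs hm)).1 h
      · exact (hno D'' (Relation.ReflTransGen.head hs hm)).2 h
    have hmin : D.IsMinimal := by
      refine ⟨hD, fun A hA => ?_, fun e he => ?_, fun x hx => ?_⟩
      · obtain ⟨a, ha⟩ := hA
        have h1 : Nat.card (D.contract A).V ≤ Nat.card D.V :=
          Nat.card_le_card_of_surjective _ (Quot.mk_surjective (r := fun x y : D.V =>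
            ∃ e ∈ A, D.tail e = x ∧ D.head e = y))
        have h2 : Nat.card (D.contract A).E < Nat.card D.E :=
          Finite.card_subtype_lt (p := fun e => e ∉ A) (x := a) (not_not.2 ha)
        obtain ⟨j, hj⟩ := (isCutEmbedding_contract D A).exists_weighting
          (step _ (CutMinorStep.contract D A) (by omega))
        refine ⟨j, fun S hS hd => hj S hS fun e he => ?_⟩
        exact ⟨⟨e, Set.disjoint_left.1 hd he⟩, rfl⟩
      · have h2 : Nat.card (D.deleteEdge e).E < Nat.card D.E :=
          Finite.card_subtype_lt (p := fun f => f ≠ e) (x := e) (not_not.2 rfl)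
        have h1 : Nat.card (D.deleteEdge e).V = Nat.card D.V := rfl
        exact hD (he.hasOddWeighting_iff.1 (step _ (CutMinorStep.deleteEdge D e he) (by omega)))
      · have h2 : Nat.card (D.deleteIsolated x hx).V < Nat.card D.V :=
          Finite.card_subtype_lt (p := fun y => y ≠ x) (x := x) (not_not.2 rfl)
        have h1 : Nat.card (D.deleteIsolated x hx).E = Nat.card D.E := rfl
        obtain ⟨j, hj⟩ := (isCutEmbedding_deleteIsolated D x hx).exists_weighting
          (step _ (CutMinorStep.deleteIsolated D x hx) (by omega))
        exact hD ⟨j, fun S hS => hj S hS fun e _ => ⟨e, rfl⟩⟩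
    have := hno D Relation.ReflTransGen.refl
    rcases hmin.isOddDiamond_or_isOddOneDirection with h | h
    · exact this.1 h
    · exact this.2 h

end MultiDigraph

theorem mainTheorem2 (D : MultiDigraph.{u, v}) [Finite D.V] [Finite D.E] :
    (∃ J : Set D.E, D.IsOddDijoin J) ↔
      (¬ ∃ D' : MultiDigraph.{u, v}, D'.IsCutMinor D ∧ D'.IsOddDiamond) ∧
      (¬ ∃ D' : MultiDigraph.{u, v}, D'.IsCutMinor D ∧ D'.IsOddOneDirection) := by
  rw [MultiDigraph.exists_isOddDijoin_iff]
  constructor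
  · intro hw
    constructor
    · rintro ⟨D', hm, hD'⟩
      obtain ⟨⟨_, _⟩, hw'⟩ := hm.finite_and_hasOddWeighting ⟨inferInstance, inferInstance⟩ hw
      exact hD'.not_hasOddWeighting hw'
    · rintro ⟨D', hm, hD'⟩
      obtain ⟨⟨_, _⟩, hw'⟩ := hm.finite_and_hasOddWeighting ⟨inferInstance, inferInstance⟩ hw
      exact hD'.not_hasOddWeighting hw'
  · rintro ⟨h1, h2⟩
    by_contra hc
    obtain ⟨D', hm, h | h⟩ := MultiDigraph.exists_cutMinor_of_not_hasOddWeighting _ D rfl hc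
    · exact h1 ⟨D', hm, h⟩
    · exact h2 ⟨D', hm, h⟩
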